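/- Let $n,p,s_0$ be integers with $n\ge 0$, $p\ge 1$ and $1\le s_0\le p$, $s_0\le n+1$. Let $\Sigma\in\mathbb R^{p\times p}$ be symmetric positive definite and let $\sigma>0$, $\mu>0$. For $\theta\in\mathbb R^p$ let $\mathbb P_\theta$ be the law of $(y,\mathbf X)$, where $\mathbf X\in\mathbb R^{n\times p}$ has i.i.d. rows with law $\mathsf N(0,\Sigma)$ and $y=\mathbf X\theta+w$ with $w\sim\mathsf N(0,\sigma^2 I_{n\times n})$ independent of $\mathbf X$. A randomized test is a measurable function $T=T(y,\mathbf X,U)\in\{0,1\}$, with $U$ uniform on $[0,1]$ and independent of $(y,\mathbf X)$. With $\|\theta\|_0$ the number of non-zero entries of $\theta$, put, for $i\in[p]=\{1,\dots,p\}$, $$\alpha_i(T)=\sup\{\mathbb P_\theta(T=1):\ \theta\in\mathbb R^p,\ \|\theta\|_0\le s_0,\ \theta_i=0\},$$ $$\beta_i(T;\mu)=\sup\{\mathbb P_\theta(T=0):\ \theta\in\mathbb R^p,\ \|\theta\|_0\le s_0,\ |\theta_i|\ge\mu\},$$ and, for $\alpha\in[0,1]$, define the minimax power $$1-\beta_i^{\rm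 opt}(\alpha;\mu)=\sup_T\{1-\beta_i(T;\mu):\ \alpha_i(T)\le\alpha\},$$ the supremum being over all randomized tests $T$. Let $\Phi$ be the standard normal distribution function, with $\Phi(\pm\infty)$ its limits and $\Phi^{-1}(1)=+\infty$, and for $\alpha\in[0,1]$, $u\ge 0$ let $$G(\alpha,u)=2-\Phi\big(\Phi^{-1}(1-\tfrac{\alpha}{2})+u\big)-\Phi\big(\Phi^{-1}(1-\tfrac{\alpha}{2})-u\big).$$ Then for every $i\in[p]$, every $S\subseteq[p]\setminus\{i\}$ with $|S|<s_0$, every $\alpha\in[0,1]$ and every $\ell\in\mathbb R$, $$1-\beta_i^{\rm opt}(\alpha;\mu)\ \le\ G\Big(\alpha,\frac{\mu}{\sigma_{\rm eff}(\ell)}\Big)+F_{n-s_0+1}(n-s_0+\ell),\qquad \sigma_{\rm eff}(\ell)=\frac{\sigma}{\sqrt{\Sigma_{i|S}\,(n-s_0+\ell)}},$$ where $\Sigma_{i|S}=\Sigma_{ii}-\Sigma_{i,S}\Sigma_{S,S}^{-1}\Sigma_{S,i}$ (so that $\Sigma_{i|\emptyset}=\Sigma_{ii}$), $F_k(x)=\mathbb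 P(Z_k\ge x)$ with $Z_k$ a chi-squared random variable with $k$ degrees of freedom ($Z_0=0$), and $\mu/\sigma_{\rm eff}(\ell)$ is read as $0$ when $n-s_0+\ell\le 0$. -/

import Mathlib

open MeasureTheory ProbabilityTheory

noncomputable section

namespace GaussianDesign

/-- The standard normal distribution function `Φ`, extended to `[-∞, ∞]` by `Φ(-∞) = 0` and
`Φ(∞) = 1`. -/
def Phi (x : EReal) : ℝ := (gaussianReal 0 1).real {t : ℝ | (t : EReal) ≤ x}

/-- The inverse `Φ⁻¹ : [0, 1] → [-∞, ∞]` of `Φ`, so that `Φ⁻¹(1) = ∞`. -/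
def PhiInv (q : ℝ) : EReal := sInf {x : EReal | q ≤ Phi x}

/-- `G(α, u) = 2 - Φ(Φ⁻¹(1 - α/2) + u) - Φ(Φ⁻¹(1 - α/2) - u)`. -/
def G (α u : ℝ) : ℝ :=
  2 - Phi (PhiInv (1 - α / 2) + (u : EReal)) - Phi (PhiInv (1 - α / 2) - (u : EReal))

/-- The chi-squared distribution with `k` degrees of freedom: the law of the sum of the squares of
`k` independent standard normal variables. -/
def chiSquared (k : ℕ) : Measure ℝ :=
  (Measure.pi fun _ : Fin k => gaussianReal 0 1).map fun z => ∑ j, z j ^ 2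

/-- `F_k(x) = P(Z_k ≥ x)`, where `Z_k` is chi-squared with `k` degrees of freedom. -/
def chiSquaredTail (k : ℕ) (x : ℝ) : ℝ := (chiSquared k).real {z : ℝ | x ≤ z}

/-- `Σ_{i|S} = Σ_{ii} - Σ_{i,S} (Σ_{S,S})⁻¹ Σ_{S,i}`. -/
def condVariance {p : ℕ} (Sig : Matrix (Fin p) (Fin p) ℝ) (i : Fin p) (S : Finset (Fin p)) : ℝ :=
  Sig i i - dotProduct (fun j : S => Sig i j)
    (Matrix.mulVec (Sig.submatrix (fun j : S => (j : Fin p)) (fun j : S => (j : Fin p)))⁻¹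
      (fun j : S => Sig j i))

/-- The rows `x_1, …, x_n ∈ ℝ^p` of an `n × p` design matrix. -/
abbrev Design (n p : ℕ) : Type := Fin n → EuclideanSpace ℝ (Fin p)

/-- Everything a randomized test can use: the response `y`, the design `X` and the auxiliary
randomness `U ∈ [0, 1]`. -/
abbrev Observation (n p : ℕ) : Type := (Fin n → ℝ) × Design n p × unitInterval

/-- The law `P_θ` of `(y, X, U)` where `y = X θ + w`, the rows of `X` are i.i.d. `N(0, Σ)`, the
noise `w` is `N(0, σ² I)`, `U` is uniform on `[0, 1]`, and `X`, `w`, `U` are independent. -/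
def modelLaw {p : ℕ} (n : ℕ) (Sig : Matrix (Fin p) (Fin p) ℝ) (σ : ℝ)
    (θ : EuclideanSpace ℝ (Fin p)) : Measure (Observation n p) :=
  ((Measure.pi fun _ : Fin n => multivariateGaussian 0 Sig).prod
    ((Measure.pi fun _ : Fin n => gaussianReal 0 (Real.toNNReal (σ ^ 2))).prod
      (volume : Measure unitInterval))).map
    fun a : Design n p × (Fin n → ℝ) × unitInterval =>
      (fun k => (∑ j, a.1 k j * θ j) + a.2.1 k, a.1, a.2.2)

/-- A randomized test: a measurable `{0, 1}`-valued function of `(y, X, U)`; the value `true`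
means that the null hypothesis is rejected. -/
def Test (n p : ℕ) : Type := {T : Observation n p → Bool // Measurable T}

/-- `‖θ‖₀`, the number of non-zero entries of `θ`. -/
def l0norm {p : ℕ} (θ : EuclideanSpace ℝ (Fin p)) : ℕ := {j : Fin p | θ j ≠ 0}.ncard

/-- `α_i(T)`: the supremum of `P_θ(T = 1)` over `s₀`-sparse `θ` with `θ_i = 0`. -/
def typeI {n p : ℕ} (Sig : Matrix (Fin p) (Fin p) ℝ) (σ : ℝ) (s₀ : ℕ) (i : Fin p)
    (T : Test n p) : ℝ :=
  sSup {r : ℝ | ∃ θ : EuclideanSpace ℝ (Fin p), l0norm θ ≤ s₀ ∧ θ i = 0 ∧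
    r = (modelLaw n Sig σ θ).real {a | T.1 a = true}}

/-- `β_i(T; μ)`: the supremum of `P_θ(T = 0)` over `s₀`-sparse `θ` with `|θ_i| ≥ μ`. -/
def typeII {n p : ℕ} (Sig : Matrix (Fin p) (Fin p) ℝ) (σ : ℝ) (s₀ : ℕ) (i : Fin p) (μ : ℝ)
    (T : Test n p) : ℝ :=
  sSup {r : ℝ | ∃ θ : EuclideanSpace ℝ (Fin p), l0norm θ ≤ s₀ ∧ μ ≤ |θ i| ∧
    r = (modelLaw n Sig σ θ).real {a | T.1 a = false}}

/-- The minimax power `1 - β_i^opt(α; μ) = sup {1 - β_i(T; μ) : α_i(T) ≤ α}`, over randomized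
tests `T`. -/
def minimaxPower {p : ℕ} (n : ℕ) (Sig : Matrix (Fin p) (Fin p) ℝ) (σ : ℝ) (s₀ : ℕ) (i : Fin p)
    (α μ : ℝ) : ℝ :=
  sSup {r : ℝ | ∃ T : Test n p, typeI Sig σ s₀ i T ≤ α ∧ r = 1 - typeII Sig σ s₀ i μ T}

/-- The effective noise level `σ_eff(ℓ) = σ / √(Σ_{i|S} (n - s₀ + ℓ))`. -/
def sigmaEff {p : ℕ} (n : ℕ) (Sig : Matrix (Fin p) (Fin p) ℝ) (σ : ℝ) (s₀ : ℕ) (i : Fin p)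
    (S : Finset (Fin p)) (l : ℝ) : ℝ :=
  σ / Real.sqrt (condVariance Sig i S * ((n : ℝ) - (s₀ : ℝ) + l))

end GaussianDesign

end

/-! ### Two-sided testing of a single normal mean. -/

noncomputable section
namespace GaussianDesign

/-! The worst-case errors of a test dominate its errors averaged over a prior, so it suffices to
find a prior under which testing is hard. Enlarge `S` to a set `S'` of `s₀ - 1` coordinates avoiding
`i`. Give the coefficients on `S'` the uniform law on the cube `[-R, R]^S'`, and let the coefficient
at `i` be `0` under the null and `±μ` with equal weight under the alternative; all these signals are
`s₀`-sparse.

Given the design, write the `i`th column as `X_{S'} γ + r`, with `γ` the least squares coefficients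
and `r` the residual. The part `±μ X_{S'} γ` of the mean is a translation of the prior by `±μγ`,
which is nearly invisible for large `R` (`integral_cubeUniform_add_le`). What is left is to detect a
mean `±μ r` in noise `N(0, σ² I)`. If `μ‖r‖ ≤ σu`, this is no easier than testing `N(0, 1)` against
the symmetric mixture of `N(±u, 1)`, where rejecting for large `|t|` is optimal (`neyman_pearson`,
`neyman_pearson_pi`).

The Neyman-Pearson bound is kept in Lagrangian form, affine in the size for each threshold `c`. It
can then be averaged over the prior and the design without any concavity of `G`, and `c` is chosen
only at the end (`le_G_add`).

Finally `‖r‖² / Σ_{i|S'}` is chi-squared with `n - s₀ + 1` degrees of freedom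
(`designLaw_residual_tail`), and `Σ_{i|S'} ≤ Σ_{i|S}` (`condVariance_anti`). Designs with `‖r‖² >
Σ_{i|S} (n - s₀ + ℓ)` are therefore paid for by the tail `F`, and on the others `u = μ/σ_eff(ℓ)` is
admissible. -/

lemma Phi_coe (x : ℝ) : Phi (x : EReal) = (gaussianReal 0 1).real (Set.Iic x) := by
  simp [Phi, Set.Iic]

lemma gaussianReal_real_Ioi (u c : ℝ) :
    (gaussianReal u 1).real (Set.Ioi c) = 1 - Phi ((c - u : ℝ) : EReal) := by
  rw [Phi_coe, ← probReal_compl_eq_one_sub measurableSet_Iic, Set.compl_Iic,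
    show gaussianReal u 1 = (gaussianReal 0 1).map (· + u) by simp [gaussianReal_map_add_const],
    map_measureReal_apply (by fun_prop) measurableSet_Ioi]
  congr 1
  ext t
  simp [sub_lt_iff_lt_add]

lemma gaussianReal_real_Iio_neg (u c : ℝ) :
    (gaussianReal u 1).real (Set.Iio (-c)) = 1 - Phi ((c + u : ℝ) : EReal) := by
  have h := gaussianReal_real_Ioi (-u) c
  rw [← gaussianReal_map_neg, map_measureReal_apply (by fun_prop) measurableSet_Ioi,
    sub_neg_eq_add] at h
  rw [← h]
  congr 1
  ext t
  simp

/-- The probability that `|t| > c` when `t` is normal with mean `u` and variance one. -/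
def twoSidedPower (c u : ℝ) : ℝ := 2 - Phi ((c + u : ℝ) : EReal) - Phi ((c - u : ℝ) : EReal)

lemma twoSidedPower_neg (c u : ℝ) : twoSidedPower c (-u) = twoSidedPower c u := by
  simp only [twoSidedPower, sub_neg_eq_add, ← sub_eq_add_neg]
  ring

lemma gaussianReal_real_abs_gt {c : ℝ} (hc : 0 ≤ c) (u : ℝ) :
    (gaussianReal u 1).real {t | c < |t|} = twoSidedPower c u := by
  have h : {t : ℝ | c < |t|} = Set.Ioi c ∪ Set.Iio (-c) := by
    ext t
    simp [lt_abs, lt_neg]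
  rw [h, measureReal_union _ measurableSet_Iio, gaussianReal_real_Ioi, gaussianReal_real_Iio_neg,
    twoSidedPower]
  · ring
  · rw [Set.disjoint_left]
    intro t h1 h2
    simp only [Set.mem_Ioi, Set.mem_Iio] at h1 h2
    linarith

/-- The likelihood ratio of the symmetric mixture of `N(±u, 1)` and `N(0, 1)` at `c`. -/
def likelihoodRatio (c u : ℝ) : ℝ := Real.exp (-u ^ 2 / 2) * Real.cosh (u * c)

lemma likelihoodRatio_nonneg (c u : ℝ) : 0 ≤ likelihoodRatio c u :=
  mul_nonneg (Real.exp_pos _).le (Real.cosh_pos _).le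

lemma likelihoodRatio_mul_pdf (t u : ℝ) :
    likelihoodRatio t u * gaussianPDFReal 0 1 t =
      1 / 2 * (gaussianPDFReal u 1 t + gaussianPDFReal (-u) 1 t) := by
  have h1 : Real.exp (-(t - u) ^ 2 / 2) =
      Real.exp (-u ^ 2 / 2) * Real.exp (u * t) * Real.exp (-t ^ 2 / 2) := by
    rw [← Real.exp_add, ← Real.exp_add]; ring_nf
  have h2 : Real.exp (-(t + u) ^ 2 / 2) =
      Real.exp (-u ^ 2 / 2) * Real.exp (-(u * t)) * Real.exp (-t ^ 2 / 2) := by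
    rw [← Real.exp_add, ← Real.exp_add]; ring_nf
  simp only [gaussianPDFReal, likelihoodRatio, Real.cosh_eq, NNReal.coe_one, mul_one, sub_zero,
    sub_neg_eq_add, h1, h2]
  ring

/-- The Neyman-Pearson inequality for the two-sided test of `N(0, 1)` against the symmetric mixture
of `N(±u, 1)`. -/
lemma neyman_pearson {c : ℝ} (hc : 0 ≤ c) (u : ℝ) {f : ℝ → ℝ} (hf : Measurable f)
    (h0 : ∀ t, 0 ≤ f t) (h1 : ∀ t, f t ≤ 1) :
    1 / 2 * ((∫ t, f t ∂gaussianReal u 1) + ∫ t, f t ∂gaussianReal (-u) 1) ≤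
      likelihoodRatio c u * (∫ t, f t ∂gaussianReal 0 1) +
        (twoSidedPower c u - likelihoodRatio c u * twoSidedPower c 0) := by
  classical
  set A : Set ℝ := {t | c < |t|} with hA
  have hAm : MeasurableSet A := measurableSet_lt measurable_const (by fun_prop)
  set χ : ℝ → ℝ := A.indicator 1 with hχ
  have hχm : Measurable χ := measurable_one.indicator hAm
  have hχi (m : ℝ) : ∫ t, χ t ∂gaussianReal m 1 = twoSidedPower c m := by
    rw [hχ, integral_indicator_one hAm, gaussianReal_real_abs_gt hc]
  have hint (g : ℝ → ℝ) (hg : Measurable g) (hb : ∀ t, ‖g t‖ ≤ 1) (m : ℝ) :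
      Integrable (fun t => gaussianPDFReal m 1 t * g t) :=
    (integrable_gaussianPDFReal m 1).mul_bdd hg.aestronglyMeasurable (ae_of_all _ hb)
  have hfb : ∀ t, ‖f t‖ ≤ 1 := fun t => by
    rw [Real.norm_eq_abs, abs_of_nonneg (h0 t)]; exact h1 t
  have hχb : ∀ t, ‖χ t‖ ≤ 1 := fun t => by
    by_cases h : t ∈ A <;> simp [hχ, h]
  have hc0 := hχi 0
  have hcu := hχi u
  have hcn := hχi (-u)
  rw [twoSidedPower_neg] at hcn
  -- The integrand is the standard density times `(likelihoodRatio t u - likelihoodRatio c u) * (χ t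
  -- - f t)`. Since `cosh` increases with the absolute value of its argument, both factors are
  -- nonnegative where `c < |t|` and nonpositive elsewhere.
  have key : 0 ≤ ∫ t, ((1 / 2 * (gaussianPDFReal u 1 t * χ t + gaussianPDFReal (-u) 1 t * χ t)
      - likelihoodRatio c u * (gaussianPDFReal 0 1 t * χ t))
      - (1 / 2 * (gaussianPDFReal u 1 t * f t + gaussianPDFReal (-u) 1 t * f t)
      - likelihoodRatio c u * (gaussianPDFReal 0 1 t * f t))) := by
    refine integral_nonneg fun t => ?_
    have e : ((1 / 2 * (gaussianPDFReal u 1 t * χ t + gaussianPDFReal (-u) 1 t * χ t)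
      - likelihoodRatio c u * (gaussianPDFReal 0 1 t * χ t))
      - (1 / 2 * (gaussianPDFReal u 1 t * f t + gaussianPDFReal (-u) 1 t * f t)
      - likelihoodRatio c u * (gaussianPDFReal 0 1 t * f t))) =
      (likelihoodRatio t u - likelihoodRatio c u) * (χ t - f t) * gaussianPDFReal 0 1 t := by
      linear_combination (-(χ t - f t)) * likelihoodRatio_mul_pdf t u
    simp only [Pi.zero_apply]
    rw [e]
    refine mul_nonneg ?_ (gaussianPDFReal_nonneg _ _ _)
    by_cases ht : t ∈ A
    · have : c < |t| := ht
      refine mul_nonneg (sub_nonneg.2 ?_) ?_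
      · refine mul_le_mul_of_nonneg_left ?_ (Real.exp_pos _).le
        rw [Real.cosh_le_cosh, abs_mul, abs_mul, abs_of_nonneg hc]
        exact mul_le_mul_of_nonneg_left this.le (abs_nonneg _)
      · simp [hχ, ht, h1 t]
    · have : |t| ≤ c := not_lt.1 ht
      refine mul_nonneg_of_nonpos_of_nonpos (sub_nonpos.2 ?_) ?_
      · refine mul_le_mul_of_nonneg_left ?_ (Real.exp_pos _).le
        rw [Real.cosh_le_cosh, abs_mul, abs_mul, abs_of_nonneg hc]
        exact mul_le_mul_of_nonneg_left this (abs_nonneg _)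
      · simp [hχ, ht, h0 t]
  have comb (g : ℝ → ℝ) (hg : Measurable g) (hb : ∀ t, ‖g t‖ ≤ 1) :
      Integrable (fun t => 1 / 2 * (gaussianPDFReal u 1 t * g t + gaussianPDFReal (-u) 1 t * g t)
        - likelihoodRatio c u * (gaussianPDFReal 0 1 t * g t)) ∧
      ∫ t, (1 / 2 * (gaussianPDFReal u 1 t * g t + gaussianPDFReal (-u) 1 t * g t)
        - likelihoodRatio c u * (gaussianPDFReal 0 1 t * g t)) =
      1 / 2 * ((∫ t, gaussianPDFReal u 1 t * g t) + ∫ t, gaussianPDFReal (-u) 1 t * g t)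
        - likelihoodRatio c u * ∫ t, gaussianPDFReal 0 1 t * g t := by
    have i1 : Integrable (fun t =>
        1 / 2 * (gaussianPDFReal u 1 t * g t + gaussianPDFReal (-u) 1 t * g t)) :=
      ((hint g hg hb u).add (hint g hg hb (-u))).const_mul _
    have i2 := (hint g hg hb 0).const_mul (likelihoodRatio c u)
    refine ⟨i1.sub i2, ?_⟩
    rw [integral_sub i1 i2, integral_const_mul, integral_const_mul,
      integral_add (hint g hg hb u) (hint g hg hb (-u))]
  rw [integral_sub (comb χ hχm hχb).1 (comb f hf hfb).1, (comb χ hχm hχb).2, (comb f hf hfb).2]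
    at key
  simp only [integral_gaussianReal_eq_integral_smul one_ne_zero, smul_eq_mul] at hc0 hcu hcn ⊢
  rw [hc0, hcu, hcn] at key
  linarith

/-- This is `neyman_pearson` for the test that never rejects. It lets the bound survive on bad
designs, where the indicator alone must cover a power of at most one. -/
lemma twoSidedPower_sub_nonneg {c : ℝ} (hc : 0 ≤ c) (u : ℝ) :
    0 ≤ twoSidedPower c u - likelihoodRatio c u * twoSidedPower c 0 := by
  simpa using neyman_pearson hc u (f := fun _ => 0) measurable_const (by simp) (by simp)

end GaussianDesign
end

/-! ### Reduction of vector noise to one dimension. -/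

noncomputable section
namespace GaussianDesign

open Matrix WithLp in
/-- Isotropic Gaussian noise splits into an independent sum of a Gaussian variable along a short
vector and a remainder. -/
lemma exists_gaussian_decomposition {n : ℕ} {σ u : ℝ} (hu : 0 < u) (a : Fin n → ℝ)
    (ha : ∑ k, a k ^ 2 ≤ σ ^ 2 * u ^ 2) :
    ∃ η : Measure (Fin n → ℝ), IsProbabilityMeasure η ∧
      (Measure.pi fun _ : Fin n => gaussianReal 0 (Real.toNNReal (σ ^ 2))) =
        ((gaussianReal 0 1).prod η).map fun q => (q.1 / u) • a + q.2 := by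
  -- The covariance left after removing `(t / u) • a` from the noise. By Cauchy-Schwarz it is
  -- positive semidefinite exactly because `‖a‖² ≤ σ² u²`.
  set Q : Matrix (Fin n) (Fin n) ℝ := σ ^ 2 • (1 : Matrix (Fin n) (Fin n) ℝ) -
    (u ^ 2)⁻¹ • vecMulVec a a with hQ
  have hquad (x : Fin n → ℝ) : x ⬝ᵥ Q *ᵥ x = σ ^ 2 * (x ⬝ᵥ x) - (u ^ 2)⁻¹ * (x ⬝ᵥ a) ^ 2 := by
    rw [hQ, sub_mulVec, smul_mulVec, smul_mulVec, one_mulVec, vecMulVec_mulVec, dotProduct_sub,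
      dotProduct_smul, dotProduct_smul]
    simp [dotProduct_comm a x]
    left
    ring
  have hQp : Q.PosSemidef := by
    refine PosSemidef.of_dotProduct_mulVec_nonneg ?_ fun x => ?_
    · ext i j
      simp [hQ, vecMulVec_apply, mul_comm, one_apply, eq_comm]
    · rw [star_trivial, hquad, sub_nonneg, inv_mul_le_iff₀ (by positivity)]
      have := Finset.sum_mul_sq_le_sq_mul_sq Finset.univ x a
      simp only [dotProduct, ← pow_two]
      nlinarith [Finset.sum_nonneg fun (i : Fin n) (_ : i ∈ Finset.univ) => sq_nonneg (x i)]
  refine ⟨(multivariateGaussian 0 Q).map ofLp, Measure.isProbabilityMeasure_map (by fun_prop), ?_⟩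
  have e : (Measure.pi fun _ : Fin n => gaussianReal 0 (Real.toNNReal (σ ^ 2))).map (toLp 2) =
      ((gaussianReal 0 1).map fun t => (t / u) • toLp 2 a) ∗ multivariateGaussian 0 Q := by
    have : IsProbabilityMeasure ((gaussianReal 0 1).map fun t => (t / u) • toLp 2 a) :=
      Measure.isProbabilityMeasure_map (by fun_prop)
    apply Measure.ext_of_charFun (E := EuclideanSpace ℝ (Fin n))
    ext t
    rw [charFun_conv, charFun_multivariateGaussian hQp, hquad, charFun_pi]
    have h1 : charFun ((gaussianReal 0 1).map fun s => (s / u) • toLp 2 a) t =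
        charFun (gaussianReal 0 1) ((t.ofLp ⬝ᵥ a) / u) := by
      rw [charFun_apply, charFun_apply_real, integral_map (by fun_prop) (by fun_prop)]
      congr 1
      ext s
      congr 2
      rw [real_inner_smul_left]
      simp [PiLp.inner_apply, dotProduct]
      ring
    simp_rw [h1, charFun_gaussianReal, ← Complex.exp_sum, ← Complex.exp_add]
    congr 1
    simp [dotProduct, Real.coe_toNNReal _ (sq_nonneg σ), Finset.mul_sum]
    have h2 : ∑ k, (σ : ℂ) ^ 2 * (t.ofLp k : ℂ) ^ 2 / 2 =
        (∑ k, (σ : ℂ) ^ 2 * ((t.ofLp k : ℂ) * t.ofLp k)) / 2 := by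
      rw [Finset.sum_div]
      exact Finset.sum_congr rfl fun k _ => by ring
    rw [h2]
    ring
  have e2 := congrArg (Measure.map (ofLp (p := 2))) e
  rw [Measure.map_map (by fun_prop) (by fun_prop)] at e2
  simp only [Function.comp_def, Measure.map_id'] at e2
  rw [e2, Measure.conv]
  conv_lhs => rw [← Measure.map_id (μ := multivariateGaussian 0 Q)]
  conv_rhs => rw [← Measure.map_id (μ := gaussianReal 0 1)]
  rw [Measure.map_prod_map _ _ (by fun_prop) (by fun_prop),
    Measure.map_prod_map _ _ (by fun_prop) (by fun_prop),
    Measure.map_map (by fun_prop) (by fun_prop), Measure.map_map (by fun_prop) (by fun_prop),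
    Measure.map_map (by fun_prop) (by fun_prop)]
  rfl

/-- With the noise written as `(t / u) • a + z`, adding `s • a` to the mean only moves the law of
`t` from `N(0, 1)` to `N(su, 1)`. Averaging over `z` turns `g` into a randomized test `f` of the
single variable `t`. -/
lemma neyman_pearson_pi {n : ℕ} {σ u c : ℝ} (hu : 0 < u) (hc : 0 ≤ c) (a : Fin n → ℝ)
    (ha : ∑ k, a k ^ 2 ≤ σ ^ 2 * u ^ 2) {g : (Fin n → ℝ) → ℝ} (hg : Measurable g)
    (h0 : ∀ y, 0 ≤ g y) (h1 : ∀ y, g y ≤ 1) (b : Fin n → ℝ) :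
    1 / 2 * ((∫ w, g (b + a + w) ∂(Measure.pi fun _ => gaussianReal 0 (Real.toNNReal (σ ^ 2)))) +
      ∫ w, g (b - a + w) ∂(Measure.pi fun _ => gaussianReal 0 (Real.toNNReal (σ ^ 2)))) ≤
      likelihoodRatio c u *
        (∫ w, g (b + w) ∂(Measure.pi fun _ => gaussianReal 0 (Real.toNNReal (σ ^ 2)))) +
        (twoSidedPower c u - likelihoodRatio c u * twoSidedPower c 0) := by
  obtain ⟨η, hη, e⟩ := exists_gaussian_decomposition hu a ha
  set f : ℝ → ℝ := fun t => ∫ z, g (b + ((t / u) • a + z)) ∂η with hf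
  have hfm : Measurable f :=
    (StronglyMeasurable.integral_prod_right (f := fun t z => g (b + ((t / u) • a + z)))
      (Measurable.stronglyMeasurable (by fun_prop))).measurable
  have hgi {α : Type} [MeasurableSpace α] (ν : Measure α) [IsProbabilityMeasure ν]
      (φ : α → Fin n → ℝ) (hφ : Measurable φ) : Integrable (fun t => g (φ t)) ν :=
    Integrable.of_bound (hg.comp hφ).aestronglyMeasurable 1 (ae_of_all _ fun t => by
      rw [Real.norm_eq_abs, abs_of_nonneg (h0 _)]; exact h1 _)
  have key (s : ℝ) : ∫ w, g (b + s • a + w)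
      ∂(Measure.pi fun _ => gaussianReal 0 (Real.toNNReal (σ ^ 2))) =
      ∫ t, f t ∂gaussianReal (s * u) 1 := by
    have hgm : Measurable fun w => g (b + s • a + w) := hg.comp (measurable_const_add _)
    rw [e, integral_map (by fun_prop) 
      hgm.aestronglyMeasurable,
      integral_prod _ (hgi _ _ (by fun_prop)),
      show gaussianReal (s * u) 1 = (gaussianReal 0 1).map (· + s * u) by
        simp [gaussianReal_map_add_const], integral_map (by fun_prop) hfm.aestronglyMeasurable]
    congr 1
    ext t
    simp only [hf]
    congr 1
    ext z
    congr 1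
    rw [add_div, mul_div_cancel_right₀ _ hu.ne', add_smul]
    abel
  have k0 := key 0
  have k1 := key 1
  have k2 := key (-1)
  simp only [zero_smul, one_smul, neg_smul, add_zero, zero_mul, one_mul, neg_mul,
    ← sub_eq_add_neg] at k0 k1 k2
  rw [k0, k1, k2]
  refine neyman_pearson hc u hfm (fun t => integral_nonneg fun z => h0 _) fun t => ?_
  calc f t ≤ ∫ _, (1 : ℝ) ∂η :=
        integral_mono (hgi _ _ (by fun_prop)) (integrable_const _) fun z => h1 _
    _ = 1 := by simp

end GaussianDesign
end

/-! ### The uniform prior on a cube and its translates. -/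

noncomputable section
namespace GaussianDesign

/-- The uniform distribution on the cube `[-R, R]^ι`. -/
def cubeUniform (ι : Type*) [Fintype ι] (R : ℝ) : Measure (ι → ℝ) :=
  ProbabilityTheory.cond volume (Metric.closedBall 0 R)

variable {ι : Type*} [Fintype ι]

lemma volume_real_closedBall {R : ℝ} (hR : 0 ≤ R) (x : ι → ℝ) :
    (volume : Measure (ι → ℝ)).real (Metric.closedBall x R) = (2 * R) ^ Fintype.card ι := by
  rw [measureReal_def, Real.volume_pi_closedBall x hR, ENNReal.toReal_ofReal (by positivity)]

lemma isProbabilityMeasure_cubeUniform {R : ℝ} (hR : 0 < R) :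
    IsProbabilityMeasure (cubeUniform ι R) :=
  cond_isProbabilityMeasure_of_finite (Metric.measure_closedBall_pos _ _ hR).ne'
    measure_closedBall_lt_top.ne

lemma integral_cubeUniform {R : ℝ} (hR : 0 < R) (g : (ι → ℝ) → ℝ) :
    ∫ t, g t ∂cubeUniform ι R =
      ((2 * R) ^ Fintype.card ι)⁻¹ * ∫ t in Metric.closedBall 0 R, g t := by
  rw [cubeUniform, ProbabilityTheory.cond, integral_smul_measure, ENNReal.toReal_inv,
    ← measureReal_def, volume_real_closedBall hR.le, smul_eq_mul]

/-- A bound for the total variation distance between the uniform distribution on a cube of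
half-side `R` in dimension `d` and its translate by a vector of norm `r`. -/
def cubeShiftError (d : ℕ) (R r : ℝ) : ℝ := min 1 ((1 + r / R) ^ d - 1)

lemma cubeShiftError_nonneg (d : ℕ) {R r : ℝ} (hR : 0 ≤ R) (hr : 0 ≤ r) :
    0 ≤ cubeShiftError d R r :=
  le_min zero_le_one (sub_nonneg.2 (one_le_pow₀ (by have := div_nonneg hr hR; linarith)))

lemma cubeShiftError_le_one (d : ℕ) (R r : ℝ) : cubeShiftError d R r ≤ 1 := min_le_left _ _

lemma tendsto_cubeShiftError (d : ℕ) (r : ℝ) :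
    Filter.Tendsto (fun R : ℝ => cubeShiftError d R r) Filter.atTop (nhds 0) := by
  have h : Filter.Tendsto (fun R : ℝ => min 1 ((1 + r / R) ^ d - 1)) Filter.atTop
      (nhds (min 1 ((1 + 0) ^ d - 1))) :=
    tendsto_const_nhds.min (((tendsto_const_nhds.add
      (Filter.Tendsto.div_atTop tendsto_const_nhds Filter.tendsto_id)).pow d).sub_const 1)
  simpa [cubeShiftError] using h

/-- The translate by `δ` of the cube of half-side `R` lies in the concentric cube of half-side `R +
‖δ‖`, where the norm is the sup norm. As `0 ≤ g ≤ 1`, the excess is at most the difference of the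
volumes of the two concentric cubes, divided by the volume of the smaller. -/
lemma integral_cubeUniform_add_le {R : ℝ} (hR : 0 < R) {g : (ι → ℝ) → ℝ} (hg : Measurable g)
    (h0 : ∀ t, 0 ≤ g t) (h1 : ∀ t, g t ≤ 1) (δ : ι → ℝ) :
    ∫ t, g (t + δ) ∂cubeUniform ι R ≤
      (∫ t, g t ∂cubeUniform ι R) + cubeShiftError (Fintype.card ι) R ‖δ‖ := by
  have hP := isProbabilityMeasure_cubeUniform (ι := ι) hR
  have hgb : ∀ t, ‖g t‖ ≤ 1 := fun t => by
    rw [Real.norm_eq_abs, abs_of_nonneg (h0 _)]; exact h1 _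
  have hgi (ν : Measure (ι → ℝ)) [IsFiniteMeasure ν] (φ : (ι → ℝ) → ι → ℝ) (hφ : Measurable φ) :
      Integrable (fun t => g (φ t)) ν :=
    Integrable.of_bound (hg.comp hφ).aestronglyMeasurable 1 (ae_of_all _ fun t => hgb _)
  rw [cubeShiftError, ← min_add_add_left]
  refine le_min ?_ ?_
  · have : 0 ≤ ∫ t, g t ∂cubeUniform ι R := integral_nonneg h0
    calc ∫ t, g (t + δ) ∂cubeUniform ι R ≤ ∫ _, (1 : ℝ) ∂cubeUniform ι R :=
          integral_mono (hgi _ _ (by fun_prop)) (integrable_const _) fun t => h1 _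
      _ = 1 := by simp
      _ ≤ _ := by linarith
  · set B : Set (ι → ℝ) := Metric.closedBall 0 R
    set B' : Set (ι → ℝ) := Metric.closedBall 0 (R + ‖δ‖)
    have hBB : B ⊆ B' := Metric.closedBall_subset_closedBall (by linarith [norm_nonneg δ])
    have fin (x : ι → ℝ) (r : ℝ) : IsFiniteMeasure (volume.restrict (Metric.closedBall x r)) :=
      ⟨by rw [Measure.restrict_apply_univ]; exact measure_closedBall_lt_top⟩
    have e1 : ∫ t in B, g (t + δ) = ∫ t in Metric.closedBall δ R, g t := by
      have h := (measurePreserving_add_right volume δ).setIntegral_preimage_emb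
        (measurableEmbedding_addRight δ) g (Metric.closedBall δ R)
      rw [← h]
      congr 2
      ext t
      simp [B, dist_eq_norm]
    have e2 : ∫ t in Metric.closedBall δ R, g t ≤ ∫ t in B', g t := by
      refine setIntegral_mono_set (hgi _ id measurable_id) (ae_of_all _ h0)
        (LE.le.eventuallyLE ?_)
      refine Metric.closedBall_subset_closedBall' ?_
      simp
    have e3 : ∫ t in B', g t ≤
        (∫ t in B, g t) + ((2 * (R + ‖δ‖)) ^ Fintype.card ι - (2 * R) ^ Fintype.card ι) := by
      have hi : IntegrableOn g B' := hgi (volume.restrict B') id measurable_id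
      rw [← Set.union_sdiff_cancel hBB, setIntegral_union Set.disjoint_sdiff_right
        (Metric.isClosed_closedBall.measurableSet.diff Metric.isClosed_closedBall.measurableSet)
        (hi.mono_set hBB) (hi.mono_set Set.sdiff_subset)]
      gcongr
      calc ∫ t in B' \ B, g t ≤ ∫ t in B' \ B, (1 : ℝ) :=
            integral_mono (hi.mono_set Set.sdiff_subset)
              (integrableOn_const (measure_ne_top_of_subset
                Set.sdiff_subset measure_closedBall_lt_top.ne)) h1
        _ = _ := by
          rw [setIntegral_const, smul_eq_mul, mul_one, measureReal_sdiff hBB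
            Metric.isClosed_closedBall.measurableSet measure_closedBall_lt_top.ne,
            volume_real_closedBall (by positivity), volume_real_closedBall hR.le]
    rw [integral_cubeUniform hR, integral_cubeUniform hR, e1]
    have hV : 0 < (2 * R) ^ Fintype.card ι := by positivity
    have e4 : (1 + ‖δ‖ / R) ^ Fintype.card ι =
        ((2 * R) ^ Fintype.card ι)⁻¹ * (2 * (R + ‖δ‖)) ^ Fintype.card ι := by
      rw [← inv_pow, ← mul_pow]
      congr 1
      field_simp
    rw [e4]
    calc _ ≤ ((2 * R) ^ Fintype.card ι)⁻¹ * ((∫ t in B, g t) +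
          ((2 * (R + ‖δ‖)) ^ Fintype.card ι - (2 * R) ^ Fintype.card ι)) := by
          gcongr; exact e2.trans e3
      _ = _ := by field_simp; rfl

end GaussianDesign
end

/-! ### Least squares residuals and the chi-squared law. -/

noncomputable section
namespace GaussianDesign
open Matrix WithLp

section LeastSquares

variable {n : ℕ} {ι : Type*} [Fintype ι] [DecidableEq ι]

/-- The least squares coefficients of `z` on the columns of `A`. -/
def leastSquares (A : Matrix (Fin n) ι ℝ) (z : Fin n → ℝ) : ι → ℝ :=
  (Aᵀ * A)⁻¹ *ᵥ (Aᵀ *ᵥ z)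

/-- The least squares residual of `z` on the columns of `A`. -/
def residual (A : Matrix (Fin n) ι ℝ) (z : Fin n → ℝ) : Fin n → ℝ :=
  z - A *ᵥ leastSquares A z

lemma transpose_mulVec_residual {A : Matrix (Fin n) ι ℝ} (hA : IsUnit (Aᵀ * A).det)
    (z : Fin n → ℝ) : Aᵀ *ᵥ residual A z = 0 := by
  rw [residual, mulVec_sub, leastSquares, mulVec_mulVec, mulVec_mulVec,
    Matrix.mul_nonsing_inv _ hA, one_mulVec, sub_self]

lemma residual_add_mulVec {A : Matrix (Fin n) ι ℝ} (hA : IsUnit (Aᵀ * A).det)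
    (g : ι → ℝ) (z : Fin n → ℝ) : residual A (A *ᵥ g + z) = residual A z := by
  rw [residual, residual, leastSquares, leastSquares, mulVec_add, mulVec_add, mulVec_mulVec,
    mulVec_mulVec g, Matrix.mul_assoc, Matrix.nonsing_inv_mul _ hA, one_mulVec, mulVec_add]
  abel

lemma residual_smul (A : Matrix (Fin n) ι ℝ) (s : ℝ) (z : Fin n → ℝ) :
    residual A (s • z) = s • residual A z := by
  simp only [residual, leastSquares, mulVec_smul, smul_sub]

lemma measurable_leastSquares :
    Measurable fun q : (Fin n → ι → ℝ) × (Fin n → ℝ) => leastSquares (of q.1) q.2 := by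
  have hcont : Continuous fun q : (Fin n → ι → ℝ) × (Fin n → ℝ) => (of q.1 : Matrix _ _ ℝ) :=
    continuous_fst
  have hG : Continuous fun q : (Fin n → ι → ℝ) × (Fin n → ℝ) => (of q.1)ᵀ * of q.1 :=
    hcont.matrix_transpose.matrix_mul hcont
  have hv : Continuous fun q : (Fin n → ι → ℝ) × (Fin n → ℝ) =>
      ((of q.1)ᵀ * of q.1).adjugate *ᵥ ((of q.1)ᵀ *ᵥ q.2) :=
    hG.matrix_adjugate.matrix_mulVec (hcont.matrix_transpose.matrix_mulVec continuous_snd)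
  have hd : Measurable fun q : (Fin n → ι → ℝ) × (Fin n → ℝ) =>
      (((of q.1)ᵀ * of q.1).det)⁻¹ := hG.matrix_det.measurable.inv
  have := hd.smul hv.measurable
  convert this using 2 with q
  -- The inverse is the adjugate divided by the determinant, with value zero for a singular Gram
  -- matrix. This makes the map measurable on all designs, although it need not be continuous.
  rw [leastSquares, Matrix.inv_def, Ring.inverse_eq_inv', smul_mulVec]
  rfl

lemma measurable_residual :
    Measurable fun q : (Fin n → ι → ℝ) × (Fin n → ℝ) => residual (of q.1) q.2 := by
  refine measurable_snd.sub ?_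
  have hc : Continuous fun q : (Fin n → ι → ℝ) × (ι → ℝ) => of q.1 *ᵥ q.2 :=
    Continuous.matrix_mulVec (A := fun q : (Fin n → ι → ℝ) × (ι → ℝ) => of q.1)
      continuous_fst continuous_snd
  exact hc.measurable.comp (measurable_fst.prodMk measurable_leastSquares)

end LeastSquares

lemma map_norm_sq_stdGaussian {E : Type*} [NormedAddCommGroup E] [InnerProductSpace ℝ E]
    [FiniteDimensional ℝ E] [MeasurableSpace E] [BorelSpace E] :
    (stdGaussian E).map (fun x => ‖x‖ ^ 2) = chiSquared (Module.finrank ℝ E) := by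
  rw [stdGaussian, Measure.map_map (by fun_prop) (by fun_prop), chiSquared]
  congr 1
  ext x
  simp only [Function.comp_apply]
  rw [← (stdOrthonormalBasis ℝ E).sum_sq_norm_inner_right]
  simp [inner_sum, inner_smul_right, OrthonormalBasis.inner_eq_ite]

/-- For `t ∈ K` the inner products of `t` with `x` and with its projection agree, so the
characteristic function of the image is the restriction to `K` of the original one. -/
lemma map_orthogonalProjection_stdGaussian {E : Type*} [NormedAddCommGroup E]
    [InnerProductSpace ℝ E] [FiniteDimensional ℝ E] [MeasurableSpace E] [BorelSpace E]
    (K : Submodule ℝ E) :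
    (stdGaussian E).map K.orthogonalProjectionOnto = stdGaussian K := by
  apply Measure.ext_of_charFun
  ext t
  rw [charFun_apply, integral_map (by fun_prop) (by fun_prop)]
  have h := charFun_stdGaussian (t : E)
  rw [charFun_apply] at h
  simp only [Submodule.inner_orthogonalProjectionOnto_eq_of_mem_right]
  rw [charFun_stdGaussian]
  simpa using h

/-- The residual is the orthogonal projection onto the complement of the column space. Invertibility
of the Gram matrix gives that complement dimension `n - Fintype.card ι`. -/
lemma measure_residual_sq {n : ℕ} {ι : Type*} [Fintype ι] [DecidableEq ι]
    {A : Matrix (Fin n) ι ℝ} (hA : IsUnit (Aᵀ * A).det) :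
    (Measure.pi fun _ : Fin n => gaussianReal 0 1).map (fun z => ∑ k, residual A z k ^ 2) =
      chiSquared (n - Fintype.card ι) := by
  set E := EuclideanSpace ℝ (Fin n)
  set W : Submodule ℝ E := LinearMap.range (A.toEuclideanLin) with hW
  have hinj : Function.Injective A.toEuclideanLin := by
    intro x y hxy
    have : A *ᵥ ofLp x = A *ᵥ ofLp y := congrArg ofLp hxy
    have h2 := congrArg (fun v => (Aᵀ * A)⁻¹ *ᵥ (Aᵀ *ᵥ v)) this
    simp only [mulVec_mulVec, Matrix.nonsing_inv_mul _ hA, one_mulVec] at h2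
    exact ofLp_injective 2 h2
  have hWd : Module.finrank ℝ W = Fintype.card ι := by
    rw [hW, LinearMap.finrank_range_of_inj hinj]
    simp
  have hd : Module.finrank ℝ Wᗮ = n - Fintype.card ι := by
    have := W.finrank_add_finrank_orthogonal
    rw [hWd] at this
    rw [finrank_euclideanSpace_fin] at this
    omega
  have hres (z : Fin n → ℝ) : ∑ k, residual A z k ^ 2 =
      ‖Wᗮ.orthogonalProjectionOnto (toLp 2 z)‖ ^ 2 := by
    have hm : toLp 2 (residual A z) ∈ Wᗮ := by
      rw [Submodule.mem_orthogonal]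
      rintro _ ⟨x, rfl⟩
      have h := transpose_mulVec_residual hA z
      have h3 : inner ℝ (A.toEuclideanLin x) (toLp 2 (residual A z)) =
          (Aᵀ *ᵥ residual A z) ⬝ᵥ ofLp x := by
        rw [mulVec_transpose, ← dotProduct_mulVec]
        rfl
      rw [h3, h, zero_dotProduct]
    have hp : Wᗮ.orthogonalProjectionOnto (toLp 2 z) = ⟨toLp 2 (residual A z), hm⟩ := by
      apply Subtype.ext
      refine Submodule.eq_starProjection_of_mem_orthogonal' hm
        (z := A.toEuclideanLin (toLp 2 (leastSquares A z))) ?_ ?_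
      · rw [Submodule.orthogonal_orthogonal]
        exact ⟨_, rfl⟩
      · simp [residual]
    rw [hp]
    exact (EuclideanSpace.real_norm_sq_eq (toLp 2 (residual A z))).symm
  have h1 := map_norm_sq_stdGaussian (E := Wᗮ)
  rw [hd, ← map_orthogonalProjection_stdGaussian, ← map_pi_eq_stdGaussian,
    Measure.map_map (by fun_prop) (by fun_prop), Measure.map_map (by fun_prop) (by fun_prop)] at h1
  rw [← h1]
  congr 1
  ext z
  exact hres z

end GaussianDesign
end

/-! ### Almost sure full rank, and conditional variances. -/

noncomputable section
namespace GaussianDesign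
open Matrix WithLp

section FullRank

variable {E : Type*} [NormedAddCommGroup E] [NormedSpace ℝ E] [FiniteDimensional ℝ E]
  [MeasurableSpace E] [BorelSpace E]

/-- Given fewer independent vectors than the dimension, their span is a proper subspace, which the
next independent draw almost surely avoids. -/
lemma ae_linearIndependent_pi (ν : Measure E) [IsProbabilityMeasure ν]
    (hν : ∀ W : Submodule ℝ E, W ≠ ⊤ → ν W = 0) (m : ℕ) (hm : m ≤ Module.finrank ℝ E) :
    ∀ᵐ x ∂(Measure.pi fun _ : Fin m => ν), LinearIndependent ℝ x := by
  induction m with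
  | zero => exact ae_of_all _ fun x => linearIndependent_empty_type
  | succ m ih =>
    have hmp := (measurePreserving_piFinSuccAbove (fun _ : Fin (m + 1) => ν) 0)
    have hms : MeasurableSet {q : (Fin m → E) × E |
        LinearIndependent ℝ (Fin.cons q.2 q.1 : Fin (m + 1) → E)} := by
      have ho : IsOpen {x : Fin (m + 1) → E | LinearIndependent ℝ x} :=
        isOpen_setOfPred_linearIndependent
      exact ho.measurableSet.preimage
        (f := fun q : (Fin m → E) × E => (Fin.cons q.2 q.1 : Fin (m + 1) → E)) (by fun_prop)
    have key : ∀ᵐ q ∂(ν.prod (Measure.pi fun _ : Fin m => ν)),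
        LinearIndependent ℝ (Fin.cons q.1 q.2 : Fin (m + 1) → E) := by
      have hsw : ∀ᵐ q ∂((Measure.pi fun _ : Fin m => ν).prod ν),
          LinearIndependent ℝ (Fin.cons q.2 q.1 : Fin (m + 1) → E) := by
        rw [Measure.ae_prod_iff_ae_ae hms]
        filter_upwards [ih (by omega)] with x hx
        have hspan : Submodule.span ℝ (Set.range x) ≠ ⊤ := by
          intro h
          have h1 := finrank_range_le_card (R := ℝ) x
          rw [Set.finrank, h, finrank_top, Fintype.card_fin] at h1
          omega
        have h0 : ∀ᵐ y ∂ν, y ∉ Submodule.span ℝ (Set.range x) := by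
          rw [ae_iff]
          simpa using hν _ hspan
        filter_upwards [h0] with y hy
        exact linearIndependent_finCons.2 ⟨hx, hy⟩
      exact (Measure.measurePreserving_swap (μ := ν)
        (ν := Measure.pi fun _ : Fin m => ν)).quasiMeasurePreserving.ae hsw
    have := hmp.quasiMeasurePreserving.ae key
    filter_upwards [this] with x hx
    convert hx using 1
    ext j
    refine Fin.cases ?_ (fun j => ?_) j <;>
      simp [MeasurableEquiv.piFinSuccAbove, Fin.insertNthEquiv, Fin.tail]

lemma ae_span_range_eq_top_pi (ν : Measure E) [IsProbabilityMeasure ν]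
    (hν : ∀ W : Submodule ℝ E, W ≠ ⊤ → ν W = 0) (m : ℕ) (hm : Module.finrank ℝ E ≤ m) :
    ∀ᵐ x ∂(Measure.pi fun _ : Fin m => ν), Submodule.span ℝ (Set.range x) = ⊤ := by
  induction m, hm using Nat.le_induction with
  | base =>
    filter_upwards [ae_linearIndependent_pi ν hν _ le_rfl] with x hx
    exact hx.span_eq_top_of_card_eq_finrank' (by simp)
  | succ m hm ih =>
    have hmp := (measurePreserving_piFinSuccAbove (fun _ : Fin (m + 1) => ν) 0)
    have h2 := hmp.quasiMeasurePreserving.ae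
      (Measure.quasiMeasurePreserving_snd (μ := ν) (ν := Measure.pi fun _ : Fin m => ν) |>.ae ih)
    filter_upwards [h2] with x hx
    rw [eq_top_iff, ← hx]
    refine Submodule.span_mono ?_
    rintro _ ⟨j, rfl⟩
    exact ⟨Fin.succAbove 0 j, rfl⟩

end FullRank

/-- A vector killed by `Aᵀ * A` is killed by `A`, hence orthogonal to every row and so to the whole
space. -/
lemma isUnit_gram_of_span_rows {n : ℕ} {ι : Type*} [Fintype ι] [DecidableEq ι]
    {A : Matrix (Fin n) ι ℝ} (hA : Submodule.span ℝ (Set.range A.row) = ⊤) :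
    IsUnit (Aᵀ * A).det := by
  rw [← Matrix.isUnit_iff_isUnit_det, ← Matrix.mulVec_injective_iff_isUnit]
  refine (injective_iff_map_eq_zero (Aᵀ * A).mulVecLin).2 fun x hx => ?_
  have h1 : A *ᵥ x = 0 := by
    rw [← conjTranspose_mul_self_mulVec_eq_zero, conjTranspose_eq_transpose_of_trivial]
    exact hx
  have h2 : ∀ v ∈ Submodule.span ℝ (Set.range A.row), v ⬝ᵥ x = 0 := by
    intro v hv
    induction hv using Submodule.span_induction with
    | mem v hv => obtain ⟨k, rfl⟩ := hv; exact congrFun h1 k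
    | zero => simp
    | add v w _ _ h h' => rw [add_dotProduct, h, h', add_zero]
    | smul r v _ h => rw [smul_dotProduct, h, smul_zero]
  exact dotProduct_self_eq_zero.1 (h2 x (hA ▸ Submodule.mem_top))

section Covariance

variable {p : ℕ} {Sig : Matrix (Fin p) (Fin p) ℝ}

/-- The best linear predictor of `x_i` given `x_S`, as a vector `b` of coefficients of the
prediction error: the error has variance `condVariance` and is uncorrelated with `x_S`. -/
lemma exists_prediction_error (hSig : Sig.PosDef) (i : Fin p) (S : Finset (Fin p)) (hiS : i ∉ S) :
    ∃ b : Fin p → ℝ, b i = 1 ∧ (∀ j, j ∉ S → j ≠ i → b j = 0) ∧ (∀ j ∈ S, (Sig *ᵥ b) j = 0) ∧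
      b ⬝ᵥ Sig *ᵥ b = condVariance Sig i S := by
  set B : Matrix S S ℝ := Sig.submatrix (fun j : S => (j : Fin p)) (fun j : S => (j : Fin p))
  have hB : IsUnit B.det := ((hSig.submatrix Subtype.val_injective).det_pos.ne').isUnit
  set g : S → ℝ := B⁻¹ *ᵥ fun j : S => Sig j i with hg
  have hBg : B *ᵥ g = fun j : S => Sig j i := by
    rw [hg, mulVec_mulVec, Matrix.mul_nonsing_inv _ hB, one_mulVec]
  -- The coefficients of `x_i` minus its regression on `x_S`; the normal equations `hBg` make this
  -- error uncorrelated with `x_S`.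
  set b : Fin p → ℝ := fun j => if h : j ∈ S then -g ⟨j, h⟩ else if j = i then 1 else 0 with hb
  have bi : b i = 1 := by simp [hb, hiS]
  have b0 : ∀ j, j ∉ S → j ≠ i → b j = 0 := fun j h h' => by simp [hb, h, h']
  have bS : ∀ j : S, b j = -g j := fun j => by simp [hb]
  have hsum (c : Fin p → ℝ) : ∑ j, c j * b j = c i - ∑ j : S, c j * g j := by
    have e1 : ∑ j, c j * b j = ∑ j ∈ insert i S, c j * b j := by
      refine (Finset.sum_subset (Finset.subset_univ _) fun j _ hj => ?_).symm
      rw [Finset.mem_insert, not_or] at hj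
      rw [b0 j hj.2 hj.1, mul_zero]
    rw [e1, Finset.sum_insert hiS, bi, ← Finset.sum_coe_sort S (fun j => c j * b j)]
    simp only [bS, mul_neg, Finset.sum_neg_distrib]
    ring
  have hS0 : ∀ j ∈ S, (Sig *ᵥ b) j = 0 := by
    intro j hj
    have := congrFun hBg ⟨j, hj⟩
    rw [mulVec, dotProduct, hsum, ← this]
    simp [mulVec, dotProduct, B]
  refine ⟨b, bi, b0, hS0, ?_⟩
  have : b ⬝ᵥ Sig *ᵥ b = (Sig *ᵥ b) i := by
    rw [dotProduct, Finset.sum_eq_single i, bi, one_mul]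
    · intro j _ hj
      by_cases h : j ∈ S
      · rw [hS0 j h, mul_zero]
      · rw [b0 j h hj, zero_mul]
    · simp
  rw [this, mulVec, dotProduct, hsum]
  rfl

lemma condVariance_pos (hSig : Sig.PosDef) (i : Fin p) (S : Finset (Fin p)) (hiS : i ∉ S) :
    0 < condVariance Sig i S := by
  obtain ⟨b, bi, -, -, h⟩ := exists_prediction_error hSig i S hiS
  rw [← h]
  have hb : b ≠ 0 := fun h0 => by simp [h0] at bi
  simpa using hSig.dotProduct_mulVec_pos hb

/-- Predicting from more coordinates cannot increase the error. The difference `b - b'` of the two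
error vectors is supported on `S'`, hence orthogonal to `b'` for the form `Sig`, and Pythagoras
applies. -/
lemma condVariance_anti (hSig : Sig.PosDef) {i : Fin p} {S S' : Finset (Fin p)} (hSS : S ⊆ S')
    (hiS : i ∉ S') : condVariance Sig i S' ≤ condVariance Sig i S := by
  obtain ⟨b, bi, b0, -, h⟩ := exists_prediction_error hSig i S (fun h => hiS (hSS h))
  obtain ⟨b', bi', b0', hb', h'⟩ := exists_prediction_error hSig i S' hiS
  rw [← h, ← h']
  have e : (b - b') ⬝ᵥ Sig *ᵥ b' = 0 := by
    refine Finset.sum_eq_zero fun j _ => ?_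
    by_cases hj : j ∈ S'
    · rw [hb' j hj, mul_zero]
    · by_cases hji : j = i
      · subst hji; simp [bi, bi']
      · simp [b0 j (fun h => hj (hSS h)) hji, b0' j hj hji]
  have e' : b' ⬝ᵥ Sig *ᵥ (b - b') = 0 := by
    have hT : Sigᵀ = Sig := by simpa [conjTranspose_eq_transpose_of_trivial] using hSig.isHermitian.eq
    rw [dotProduct_mulVec, ← mulVec_transpose, hT, dotProduct_comm, e]
  have hn : 0 ≤ (b - b') ⬝ᵥ Sig *ᵥ (b - b') := by
    simpa using hSig.posSemidef.dotProduct_mulVec_nonneg (b - b')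
  have hs : b = b' + (b - b') := by abel
  calc b' ⬝ᵥ Sig *ᵥ b' ≤ (b' + (b - b')) ⬝ᵥ Sig *ᵥ (b' + (b - b')) := by
        rw [mulVec_add, add_dotProduct, dotProduct_add, dotProduct_add, e, e']
        linarith
    _ = _ := by rw [← hs]

end Covariance

end GaussianDesign
end

/-! ### Regression of one Gaussian column on others. -/

noncomputable section
namespace GaussianDesign
open Matrix WithLp

variable {p : ℕ} {Sig : Matrix (Fin p) (Fin p) ℝ}

/-- The functional `x ↦ ∑ j, a j * x j`. -/
def dotProductCLM (a : Fin p → ℝ) : EuclideanSpace ℝ (Fin p) →L[ℝ] ℝ := innerSL ℝ (toLp 2 a)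

lemma dotProductCLM_apply (a : Fin p → ℝ) (x : EuclideanSpace ℝ (Fin p)) :
    dotProductCLM a x = a ⬝ᵥ ofLp x := by
  simp [dotProductCLM, PiLp.inner_apply, dotProduct, mul_comm]

lemma covariance_dotProduct (hSig : Sig.PosSemidef) (a b : Fin p → ℝ) :
    cov[fun x => a ⬝ᵥ ofLp x, fun x => b ⬝ᵥ ofLp x; multivariateGaussian 0 Sig] =
      a ⬝ᵥ Sig *ᵥ b := by
  simp only [← dotProductCLM_apply]
  exact (covarianceBilin_apply_eq_cov IsGaussian.memLp_two_id _ _).symm.trans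
    (covarianceBilin_multivariateGaussian hSig _ _)

lemma map_dotProduct_multivariateGaussian (hSig : Sig.PosSemidef) (a : Fin p → ℝ) :
    (multivariateGaussian 0 Sig).map (fun x => a ⬝ᵥ ofLp x) =
      gaussianReal 0 (Real.toNNReal (a ⬝ᵥ Sig *ᵥ a)) := by
  have hG : HasGaussianLaw (fun x : EuclideanSpace ℝ (Fin p) => a ⬝ᵥ ofLp x)
      (multivariateGaussian 0 Sig) := by
    simp only [← dotProductCLM_apply]
    exact IsGaussian.hasGaussianLaw_id.map_fun (dotProductCLM a)
  rw [hG.map_eq_gaussianReal, ← covariance_dotProduct hSig, covariance_self (by fun_prop)]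
  congr 1
  simp only [← dotProductCLM_apply]
  rw [(dotProductCLM a).integral_comp_id_comm IsGaussian.integrable_id,
    integral_id_multivariateGaussian, map_zero]

/-- The coordinates of a row of the design with index in `S`. -/
def rowRestrict (S : Finset (Fin p)) (x : EuclideanSpace ℝ (Fin p)) : S → ℝ := fun j => x j

lemma measurable_rowRestrict (S : Finset (Fin p)) : Measurable (rowRestrict S) := by
  unfold rowRestrict
  fun_prop

/-- A proper subspace lies in the kernel of a nonzero functional, whose value on a row is a
nondegenerate Gaussian variable and so has no atom at zero. -/
lemma map_rowRestrict_null (hSig : Sig.PosDef) (S : Finset (Fin p)) (W : Submodule ℝ (S → ℝ))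
    (hW : W ≠ ⊤) : (multivariateGaussian 0 Sig).map (rowRestrict S) W = 0 := by
  obtain ⟨f, hf, hWf⟩ := Submodule.exists_le_ker_of_lt_top W hW.lt_top
  set a : Fin p → ℝ := fun j => if h : j ∈ S then f (Pi.single ⟨j, h⟩ 1) else 0 with ha
  have hfa (x : EuclideanSpace ℝ (Fin p)) : f (rowRestrict S x) = a ⬝ᵥ ofLp x := by
    have e1 : a ⬝ᵥ ofLp x = ∑ j ∈ S, a j * x j := by
      refine (Finset.sum_subset (Finset.subset_univ _) fun j _ hj => ?_).symm
      simp [ha, hj]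
    rw [e1, ← Finset.sum_coe_sort S (fun j => a j * x j), LinearMap.pi_apply_eq_sum_univ f]
    refine Finset.sum_congr rfl fun j _ => ?_
    have e2 : (fun k : S => if j = k then (1 : ℝ) else 0) = Pi.single j 1 := by
      ext k
      simp [Pi.single_apply, eq_comm]
    simp [ha, rowRestrict, mul_comm, e2]
  have ha0 : a ≠ 0 := by
    intro h0
    apply hf
    refine LinearMap.pi_ext' fun j => LinearMap.ext_ring ?_
    have := congrFun h0 j
    simpa [ha] using this
  have hv : 0 < a ⬝ᵥ Sig *ᵥ a := by simpa using hSig.dotProduct_mulVec_pos ha0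
  rw [Measure.map_apply (measurable_rowRestrict S) W.closed_of_finiteDimensional.measurableSet]
  refine measure_mono_null (t := (fun x => a ⬝ᵥ ofLp x) ⁻¹' {0}) (fun x hx => ?_) ?_
  · have := hWf hx
    rw [LinearMap.mem_ker, hfa] at this
    exact this
  · rw [← Measure.map_apply (by fun_prop) (measurableSet_singleton 0),
      map_dotProduct_multivariateGaussian hSig.posSemidef]
    have := nullSingletonClass_gaussianReal (μ := 0) (v := Real.toNNReal (a ⬝ᵥ Sig *ᵥ a))
      (by simpa using hv)
    exact measure_singleton _

/-- The two components are jointly Gaussian and, by `hb`, uncorrelated; hence they are independent.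
-/
lemma map_rowRestrict_prodMk (hSig : Sig.PosSemidef) (S : Finset (Fin p)) (b : Fin p → ℝ)
    (hb : ∀ j ∈ S, (Sig *ᵥ b) j = 0) :
    (multivariateGaussian 0 Sig).map (fun x => (rowRestrict S x, b ⬝ᵥ ofLp x)) =
      ((multivariateGaussian 0 Sig).map (rowRestrict S)).prod
        (gaussianReal 0 (Real.toNNReal (b ⬝ᵥ Sig *ᵥ b))) := by
  have hind : IndepFun (fun (x : EuclideanSpace ℝ (Fin p)) (j : S) => x j)
      (fun x (_ : Unit) => b ⬝ᵥ ofLp x) (multivariateGaussian 0 Sig) := by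
    refine HasGaussianLaw.indepFun_of_covariance_eval (X := fun (j : S) x => x j)
      (Y := fun (_ : Unit) x => b ⬝ᵥ ofLp x) ?_ fun j _ => ?_
    · have := IsGaussian.hasGaussianLaw_id (μ := multivariateGaussian 0 Sig) |>.map_fun
        ((ContinuousLinearMap.pi fun j : S => EuclideanSpace.proj (j : Fin p)).prod
          (ContinuousLinearMap.pi fun _ : Unit => dotProductCLM b))
      simp only [← dotProductCLM_apply]
      exact this
    · have h := covariance_dotProduct hSig (Pi.single (j : Fin p) 1) b
      simp only [single_one_dotProduct] at h
      rw [h, hb j j.2]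
  have h2 : IndepFun (rowRestrict S) (fun x => b ⬝ᵥ ofLp x) (multivariateGaussian 0 Sig) :=
    hind.comp (φ := id) (ψ := fun y : Unit → ℝ => y ()) measurable_id (by fun_prop)
  rw [(indepFun_iff_map_prod_eq_prod_map_map (measurable_rowRestrict S).aemeasurable
    (by fun_prop)).1 h2, map_dotProduct_multivariateGaussian hSig]

variable {n : ℕ}

/-- The columns of the design with index in `S`. -/
def designRestrict (S : Finset (Fin p)) (X : Design n p) : Matrix (Fin n) S ℝ :=
  of fun k => rowRestrict S (X k)

/-- The law of the design matrix. -/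
abbrev designLaw (n : ℕ) (Sig : Matrix (Fin p) (Fin p) ℝ) : Measure (Design n p) :=
  Measure.pi fun _ : Fin n => multivariateGaussian 0 Sig

lemma ae_isUnit_gram (hSig : Sig.PosDef) (S : Finset (Fin p)) (hS : S.card ≤ n) :
    ∀ᵐ X ∂designLaw n Sig, IsUnit ((designRestrict S X)ᵀ * designRestrict S X).det := by
  have hP : IsProbabilityMeasure ((multivariateGaussian 0 Sig).map (rowRestrict S)) :=
    Measure.isProbabilityMeasure_map (measurable_rowRestrict S).aemeasurable
  have h := ae_span_range_eq_top_pi ((multivariateGaussian 0 Sig).map (rowRestrict S))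
    (map_rowRestrict_null hSig S) n (by simpa using hS)
  rw [← Measure.pi_map_pi fun _ => (measurable_rowRestrict S).aemeasurable] at h
  have hm : Measurable fun (X : Design n p) k => rowRestrict S (X k) :=
    measurable_pi_lambda _ fun k => (measurable_rowRestrict S).comp (measurable_pi_apply k)
  filter_upwards [ae_of_ae_map hm.aemeasurable h] with X hX
  exact isUnit_gram_of_span_rows hX

lemma map_designRestrict_prodMk (hSig : Sig.PosSemidef) (S : Finset (Fin p)) (b : Fin p → ℝ)
    (hb : ∀ j ∈ S, (Sig *ᵥ b) j = 0) :
    (designLaw n Sig).map (fun X => (fun k => rowRestrict S (X k), fun k => b ⬝ᵥ ofLp (X k))) =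
      (Measure.pi fun _ : Fin n => (multivariateGaussian 0 Sig).map (rowRestrict S)).prod
        (Measure.pi fun _ : Fin n => gaussianReal 0 (Real.toNNReal (b ⬝ᵥ Sig *ᵥ b))) := by
  have hP : IsProbabilityMeasure ((multivariateGaussian 0 Sig).map (rowRestrict S)) :=
    Measure.isProbabilityMeasure_map (measurable_rowRestrict S).aemeasurable
  have hm : Measurable fun x : EuclideanSpace ℝ (Fin p) => (rowRestrict S x, b ⬝ᵥ ofLp x) :=
    (measurable_rowRestrict S).prodMk (by fun_prop)
  have hP2 : IsProbabilityMeasure ((multivariateGaussian 0 Sig).map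
      fun x => (rowRestrict S x, b ⬝ᵥ ofLp x)) := Measure.isProbabilityMeasure_map hm.aemeasurable
  have hm' : Measurable fun (X : Design n p) k => (rowRestrict S (X k), b ⬝ᵥ ofLp (X k)) :=
    measurable_pi_lambda _ fun k => hm.comp (measurable_pi_apply k)
  rw [← (measurePreserving_arrowProdEquivProdArrow (S → ℝ) ℝ (Fin n) _ _).map_eq,
    ← map_rowRestrict_prodMk hSig S b hb, ← Measure.pi_map_pi fun _ => hm.aemeasurable,
    Measure.map_map (MeasurableEquiv.measurable _) hm']
  rfl

lemma pi_gaussianReal_eq_map_smul (n : ℕ) {v : ℝ} (hv : 0 ≤ v) :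
    (Measure.pi fun _ : Fin n => gaussianReal 0 (Real.toNNReal v)) =
      (Measure.pi fun _ : Fin n => gaussianReal 0 1).map fun z => √v • z := by
  have h : gaussianReal 0 (Real.toNNReal v) = (gaussianReal 0 1).map (√v * ·) := by
    rw [gaussianReal_map_const_mul, mul_zero, mul_one]
    congr 1
    ext
    simp [Real.sq_sqrt hv, hv]
  have hP : IsProbabilityMeasure ((gaussianReal 0 1).map (√v * ·)) := by
    rw [← h]; infer_instance
  rw [h, ← Measure.pi_map_pi fun _ => by fun_prop]
  rfl

/-- Column `i` is a combination of the columns in `S` plus prediction errors. The residual depends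
only on these errors, which are `N(0, v)` and independent of the columns in `S`. Conditionally on
those columns its squared norm is thus `v` times a chi-squared variable. -/
lemma designLaw_residual_tail (hSig : Sig.PosDef) {i : Fin p} {S : Finset (Fin p)} (hiS : i ∉ S)
    (hS : S.card ≤ n) (c : ℝ) :
    (designLaw n Sig).real {X | condVariance Sig i S * c <
      ∑ k, residual (designRestrict S X) (fun k => X k i) k ^ 2} ≤
      chiSquaredTail (n - S.card) c := by
  obtain ⟨b, bi, b0, hb, hbv⟩ := exists_prediction_error hSig i S hiS
  set v := condVariance Sig i S with hv
  have hvpos : 0 < v := condVariance_pos hSig i S hiS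
  set Ψ : Design n p → (Fin n → S → ℝ) × (Fin n → ℝ) :=
    fun X => (fun k => rowRestrict S (X k), fun k => b ⬝ᵥ ofLp (X k)) with hΨ
  have hΨm : Measurable Ψ :=
    (measurable_pi_lambda _ fun k => (measurable_rowRestrict S).comp (measurable_pi_apply k)).prodMk
      (by fun_prop)
  set T : Set ((Fin n → S → ℝ) × (Fin n → ℝ)) :=
    {q | v * c < ∑ k, residual (of q.1) q.2 k ^ 2} with hT
  have hTm : MeasurableSet T := by
    refine measurableSet_lt measurable_const (Finset.measurable_sum _ fun k _ => ?_)
    exact ((measurable_pi_apply k).comp measurable_residual).pow_const 2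
  have hcol (X : Design n p) : (fun k => X k i) =
      designRestrict S X *ᵥ (fun j : S => -b j) + fun k => b ⬝ᵥ ofLp (X k) := by
    ext k
    have e1 : b ⬝ᵥ ofLp (X k) = ∑ j ∈ insert i S, b j * X k j := by
      refine (Finset.sum_subset (Finset.subset_univ _) fun j _ hj => ?_).symm
      rw [Finset.mem_insert, not_or] at hj
      rw [b0 j hj.2 hj.1, zero_mul]
    rw [Pi.add_apply, e1, Finset.sum_insert hiS, bi, ← Finset.sum_coe_sort S (fun j => b j * X k j)]
    simp [mulVec, dotProduct, designRestrict, rowRestrict, mul_comm]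
  have hle : designLaw n Sig {X | v * c <
      ∑ k, residual (designRestrict S X) (fun k => X k i) k ^ 2} ≤
      designLaw n Sig (Ψ ⁻¹' T) := by
    refine measure_mono_ae ?_
    filter_upwards [ae_isUnit_gram hSig S hS] with X hX hmem
    have hmem' : v * c < ∑ k, residual (designRestrict S X) (fun k => X k i) k ^ 2 := hmem
    rw [hcol, residual_add_mulVec hX] at hmem'
    exact hmem'
  have hP : IsProbabilityMeasure ((multivariateGaussian 0 Sig).map (rowRestrict S)) :=
    Measure.isProbabilityMeasure_map (measurable_rowRestrict S).aemeasurable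
  have hunit : ∀ᵐ A ∂(Measure.pi fun _ : Fin n => (multivariateGaussian 0 Sig).map (rowRestrict S)),
      IsUnit ((of A)ᵀ * of A).det := by
    filter_upwards [ae_span_range_eq_top_pi ((multivariateGaussian 0 Sig).map (rowRestrict S))
      (map_rowRestrict_null hSig S) n (by simpa using hS)] with A hA
    exact isUnit_gram_of_span_rows hA
  have hfin : designLaw n Sig (Ψ ⁻¹' T) ≤ chiSquared (n - S.card) {z | c ≤ z} := by
    rw [← Measure.map_apply hΨm hTm, hΨ, map_designRestrict_prodMk hSig.posSemidef S b hb,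
      Measure.prod_apply hTm, hbv]
    calc _ ≤ ∫⁻ _, chiSquared (n - S.card) {z | c ≤ z}
          ∂(Measure.pi fun _ : Fin n => (multivariateGaussian 0 Sig).map (rowRestrict S)) := by
          refine lintegral_mono_ae ?_
          filter_upwards [hunit] with A hA
          rw [pi_gaussianReal_eq_map_smul n hvpos.le,
            Measure.map_apply (by fun_prop) (measurable_prodMk_left hTm)]
          have hc := measure_residual_sq hA
          rw [Fintype.card_coe] at hc
          rw [← hc, show {z : ℝ | c ≤ z} = Set.Ici c from rfl, Measure.map_apply _ measurableSet_Ici]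
          · refine measure_mono fun z hz => ?_
            have hz' : v * c < ∑ k, residual (of A) (√v • z) k ^ 2 := hz
            simp only [residual_smul, Pi.smul_apply, smul_eq_mul, mul_pow, Real.sq_sqrt hvpos.le,
              ← Finset.mul_sum] at hz'
            exact (lt_of_mul_lt_mul_left hz' hvpos.le).le
          · exact Finset.measurable_sum _ fun k _ => ((measurable_pi_apply k).comp
              (measurable_residual.comp measurable_prodMk_left)).pow_const 2
      _ = _ := by simp
  have hP3 : IsProbabilityMeasure (chiSquared (n - S.card)) :=
    Measure.isProbabilityMeasure_map (Measurable.aemeasurable (by fun_prop))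
  exact ENNReal.toReal_mono (measure_ne_top _ _) (hle.trans hfin)

end GaussianDesign
end

/-! ### The functions `Φ` and `G`. -/

noncomputable section
namespace GaussianDesign

lemma Phi_le_one (x : EReal) : Phi x ≤ 1 := measureReal_le_one

lemma Phi_top : Phi ⊤ = 1 := by simp [Phi]

lemma Phi_bot : Phi ⊥ = 0 := by simp [Phi]

lemma continuous_Phi_coe : Continuous fun x : ℝ => Phi (x : EReal) := by
  have hi := integrable_gaussianPDFReal 0 1
  have h : (fun x : ℝ => Phi (x : EReal)) =
      fun x => Phi ((0 : ℝ) : EReal) + ∫ t in (0 : ℝ)..x, gaussianPDFReal 0 1 t := by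
    funext x
    have e (y : ℝ) : Phi (y : EReal) = ∫ t in Set.Iic y, gaussianPDFReal 0 1 t := by
      rw [Phi_coe, measureReal_def, gaussianReal_apply_eq_integral 0 one_ne_zero,
        ENNReal.toReal_ofReal (integral_nonneg fun t => gaussianPDFReal_nonneg _ _ _)]
    rw [e x, e 0, ← intervalIntegral.integral_Iic_sub_Iic hi.integrableOn hi.integrableOn]
    ring
  rw [h]
  exact continuous_const.add (intervalIntegral.continuous_primitive
    (fun a b => hi.intervalIntegrable) 0)

lemma strictMono_Phi_coe : StrictMono fun x : ℝ => Phi (x : EReal) := by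
  intro a b hab
  simp only [Phi_coe]
  have hU : Set.Iic b = Set.Iic a ∪ Set.Ioc a b := (Set.Iic_union_Ioc_eq_Iic hab.le).symm
  rw [hU, measureReal_union (Set.Iic_disjoint_Ioc le_rfl) measurableSet_Ioc]
  have hpos : 0 < (gaussianReal 0 1).real (Set.Ioc a b) := by
    rw [measureReal_def, ENNReal.toReal_pos_iff]
    refine ⟨pos_iff_ne_zero.2 fun h0 => ?_, measure_lt_top _ _⟩
    have := gaussianReal_absolutelyContinuous' 0 (v := 1) one_ne_zero h0
    simp only [Real.volume_Ioc, ENNReal.ofReal_eq_zero] at this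
    linarith
  linarith

lemma tendsto_Phi_coe_atTop :
    Filter.Tendsto (fun x : ℝ => Phi (x : EReal)) Filter.atTop (nhds 1) := by
  have := tendsto_cdf_atTop (gaussianReal 0 1)
  refine this.congr fun x => ?_
  rw [cdf_eq_real, Phi_coe]

lemma Phi_coe_lt_one (x : ℝ) : Phi (x : EReal) < 1 :=
  (strictMono_Phi_coe (lt_add_one x)).trans_le (Phi_le_one _)

lemma Phi_zero : Phi ((0 : ℝ) : EReal) = 1 / 2 := by
  have h := gaussianReal_real_abs_gt le_rfl 0
  have := nullSingletonClass_gaussianReal (μ := 0) (v := 1) one_ne_zero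
  have h2 : {t : ℝ | 0 < |t|} = {0}ᶜ := by
    ext t
    simp
  rw [h2, probReal_compl_eq_one_sub (measurableSet_singleton 0), measureReal_def,
    measure_singleton, twoSidedPower, add_zero, sub_zero] at h
  simp only [ENNReal.toReal_zero] at h
  linarith

/-- Continuity of `Φ` gives a preimage and strict monotonicity makes it the least point of the
defining set. The condition `1 / 2 ≤ q` makes `c` an admissible, nonnegative threshold. -/
lemma exists_PhiInv_eq_coe {q : ℝ} (hq : 1 / 2 ≤ q) (hq1 : q < 1) :
    ∃ c : ℝ, 0 ≤ c ∧ Phi (c : EReal) = q ∧ PhiInv q = c := by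
  obtain ⟨M, hM, hM0⟩ := ((tendsto_Phi_coe_atTop.eventually (lt_mem_nhds hq1)).and
    (Filter.eventually_ge_atTop 0)).exists
  obtain ⟨c, hc, hcq⟩ := intermediate_value_Icc hM0 continuous_Phi_coe.continuousOn
    (show q ∈ Set.Icc _ _ from ⟨by rw [Phi_zero]; exact hq, hM.le⟩)
  refine ⟨c, hc.1, hcq, ?_⟩
  refine IsLeast.csInf_eq ⟨hcq.ge, fun x hx => ?_⟩
  have hx' : q ≤ Phi x := hx
  induction x with
  | bot => rw [Phi_bot] at hx'; linarith
  | top => exact le_top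
  | coe x =>
    rw [← hcq] at hx'
    exact EReal.coe_le_coe_iff.2 (strictMono_Phi_coe.le_iff_le.1 hx')

lemma PhiInv_one : PhiInv 1 = ⊤ := by
  refine sInf_eq_top.2 fun x hx => ?_
  have hx' : 1 ≤ Phi x := hx
  induction x with
  | bot => rw [Phi_bot] at hx'; linarith
  | top => rfl
  | coe x => exact absurd hx' (Phi_coe_lt_one x).not_ge

lemma G_nonneg (α u : ℝ) : 0 ≤ G α u := by
  have h1 := Phi_le_one (PhiInv (1 - α / 2) + (u : EReal))
  have h2 := Phi_le_one (PhiInv (1 - α / 2) - (u : EReal))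
  unfold G
  linarith

lemma tendsto_twoSidedPower_atTop (u : ℝ) :
    Filter.Tendsto (fun c => twoSidedPower c u) Filter.atTop (nhds 0) := by
  have h1 := tendsto_Phi_coe_atTop.comp (Filter.tendsto_atTop_add_const_right _ u Filter.tendsto_id)
  have h2 := tendsto_Phi_coe_atTop.comp
    (Filter.tendsto_atTop_add_const_right _ (-u) Filter.tendsto_id)
  have := (tendsto_const_nhds (x := (2 : ℝ)).sub h1).sub h2
  norm_num [Function.comp_def, ← sub_eq_add_neg] at this
  exact this

lemma twoSidedPower_nonneg {c : ℝ} (hc : 0 ≤ c) (u : ℝ) : 0 ≤ twoSidedPower c u := by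
  rw [← gaussianReal_real_abs_gt hc]
  exact measureReal_nonneg

/-- The function `G` is the optimal value of the Neyman-Pearson bounds over all thresholds. -/
lemma le_G_add {α u r δ : ℝ} (hα : α ∈ Set.Icc (0 : ℝ) 1)
    (h : ∀ c, 0 ≤ c →
      r ≤ likelihoodRatio c u * (α - twoSidedPower c 0) + twoSidedPower c u + δ) :
    r ≤ G α u + δ := by
  rcases hα.1.eq_or_lt with h0 | hpos
  -- No finite threshold has size zero, so the bound is taken in the limit `c → ∞`; the multiplier
  -- term is nonpositive and can be dropped.
  · have hG : G α u = 0 := by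
      rw [G, ← h0, zero_div, sub_zero, PhiInv_one, EReal.top_add_coe, EReal.top_sub_coe, Phi_top]
      norm_num
    have hl : Filter.Tendsto (fun c => twoSidedPower c u + δ) Filter.atTop (nhds (0 + δ)) :=
      (tendsto_twoSidedPower_atTop u).add_const δ
    rw [hG]
    refine ge_of_tendsto hl ?_
    filter_upwards [Filter.eventually_ge_atTop 0] with c hc
    have h1 := h c hc
    have h2 := mul_nonneg (likelihoodRatio_nonneg c u) (twoSidedPower_nonneg hc 0)
    rw [← h0] at h1
    linarith
  -- The threshold `Φ⁻¹(1 - α/2)` has size exactly `α`, so the multiplier term vanishes.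
  · obtain ⟨c, hc, hcq, hci⟩ := exists_PhiInv_eq_coe (q := 1 - α / 2) (by linarith [hα.2])
      (by linarith)
    have h1 := h c hc
    have h2 : twoSidedPower c 0 = α := by
      rw [twoSidedPower, add_zero, sub_zero, hcq]
      ring
    have h3 : G α u = twoSidedPower c u := by
      rw [G, hci, twoSidedPower, EReal.coe_add, EReal.coe_sub]
    rw [h2, sub_self, mul_zero, zero_add] at h1
    rwa [h3]

end GaussianDesign
end

/-! ### Rejection probabilities, sparse signals and the bound for a fixed design. -/

noncomputable section
namespace GaussianDesign
open Matrix WithLp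

lemma integrable_of_mem_unit {α : Type*} [MeasurableSpace α] {ν : Measure α} [IsFiniteMeasure ν]
    {f : α → ℝ} (hf : Measurable f) (h0 : ∀ x, 0 ≤ f x) (h1 : ∀ x, f x ≤ 1) : Integrable f ν :=
  Integrable.of_bound hf.aestronglyMeasurable 1 (ae_of_all _ fun x => by
    rw [Real.norm_eq_abs, abs_of_nonneg (h0 x)]; exact h1 x)

lemma integral_le_one_of_mem_unit {α : Type*} [MeasurableSpace α] {ν : Measure α}
    [IsProbabilityMeasure ν] {f : α → ℝ} (hf : Measurable f) (h0 : ∀ x, 0 ≤ f x)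
    (h1 : ∀ x, f x ≤ 1) : ∫ x, f x ∂ν ≤ 1 := by
  calc ∫ x, f x ∂ν ≤ ∫ _, (1 : ℝ) ∂ν :=
        integral_mono (integrable_of_mem_unit hf h0 h1) (integrable_const _) h1
    _ = 1 := by simp

variable {n p : ℕ}

/-- The law of the noise. -/
abbrev noiseLaw (n : ℕ) (σ : ℝ) : Measure (Fin n → ℝ) :=
  Measure.pi fun _ : Fin n => gaussianReal 0 (Real.toNNReal (σ ^ 2))

/-- The probability that a randomized test rejects, given the response and the design. -/
def rejectProb (T : Test n p) (X : Design n p) (y : Fin n → ℝ) : ℝ :=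
  (volume : Measure unitInterval).real {U | T.1 (y, X, U) = true}

lemma rejectProb_nonneg (T : Test n p) (X : Design n p) (y : Fin n → ℝ) : 0 ≤ rejectProb T X y :=
  measureReal_nonneg

lemma rejectProb_le_one (T : Test n p) (X : Design n p) (y : Fin n → ℝ) : rejectProb T X y ≤ 1 :=
  measureReal_le_one

lemma measurableSet_reject (T : Test n p) : MeasurableSet {a | T.1 a = true} :=
  T.2 (measurableSet_singleton true)

lemma measurable_rejectProb (T : Test n p) :
    Measurable fun q : Design n p × (Fin n → ℝ) => rejectProb T q.1 q.2 := by
  have hs : MeasurableSet {a : (Design n p × (Fin n → ℝ)) × unitInterval |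
      T.1 (a.1.2, a.1.1, a.2) = true} :=
    (measurableSet_reject T).preimage
      (f := fun a : (Design n p × (Fin n → ℝ)) × unitInterval => (a.1.2, a.1.1, a.2)) (by fun_prop)
  exact (measurable_measure_prodMk_left (ν := (volume : Measure unitInterval)) hs).ennreal_toReal

/-- The probability of rejection given the design when the mean response is `b`. -/
def rejectProbMean (σ : ℝ) (T : Test n p) (X : Design n p) (b : Fin n → ℝ) : ℝ :=
  ∫ w, rejectProb T X (b + w) ∂noiseLaw n σ

lemma measurable_rejectProbMean (σ : ℝ) (T : Test n p) :
    Measurable fun q : Design n p × (Fin n → ℝ) => rejectProbMean σ T q.1 q.2 := by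
  have h : Measurable fun a : (Design n p × (Fin n → ℝ)) × (Fin n → ℝ) =>
      rejectProb T a.1.1 (a.1.2 + a.2) :=
    (measurable_rejectProb T).comp
      (g := fun q : Design n p × (Fin n → ℝ) => rejectProb T q.1 q.2)
      (f := fun a : (Design n p × (Fin n → ℝ)) × (Fin n → ℝ) => (a.1.1, a.1.2 + a.2)) (by fun_prop)
  exact (h.stronglyMeasurable.integral_prod_right (ν := noiseLaw n σ)).measurable

lemma rejectProbMean_nonneg (σ : ℝ) (T : Test n p) (X : Design n p) (b : Fin n → ℝ) :
    0 ≤ rejectProbMean σ T X b := integral_nonneg fun _ => rejectProb_nonneg _ _ _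

lemma measurable_rejectProb_right (T : Test n p) (X : Design n p) :
    Measurable fun y => rejectProb T X y :=
  (measurable_rejectProb T).comp measurable_prodMk_left

lemma rejectProbMean_le_one (σ : ℝ) (T : Test n p) (X : Design n p) (b : Fin n → ℝ) :
    rejectProbMean σ T X b ≤ 1 :=
  integral_le_one_of_mem_unit
    ((measurable_rejectProb_right T X).comp (measurable_const_add b))
    (fun _ => rejectProb_nonneg _ _ _) fun _ => rejectProb_le_one _ _ _

section Model

variable (Sig : Matrix (Fin p) (Fin p) ℝ) (σ : ℝ)

lemma measurable_modelMap (θ : EuclideanSpace ℝ (Fin p)) :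
    Measurable fun a : Design n p × (Fin n → ℝ) × unitInterval =>
      ((fun k => (∑ j, a.1 k j * θ j) + a.2.1 k, a.1, a.2.2) : Observation n p) := by
  fun_prop

instance isProbabilityMeasure_modelLaw (θ : EuclideanSpace ℝ (Fin p)) :
    IsProbabilityMeasure (modelLaw n Sig σ θ) :=
  Measure.isProbabilityMeasure_map (measurable_modelMap θ).aemeasurable

lemma modelLaw_reject (T : Test n p) (θ : EuclideanSpace ℝ (Fin p)) :
    (modelLaw n Sig σ θ).real {a | T.1 a = true} =
      ∫ X, rejectProbMean σ T X (fun k => ∑ j, X k j * θ j) ∂designLaw n Sig := by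
  have hs := (measurableSet_reject T).preimage (measurable_modelMap (n := n) θ)
  set A := (fun a : Design n p × (Fin n → ℝ) × unitInterval =>
    ((fun k => (∑ j, a.1 k j * θ j) + a.2.1 k, a.1, a.2.2) : Observation n p)) ⁻¹'
      {a | T.1 a = true} with hA
  have hi : Integrable (A.indicator (1 : Design n p × (Fin n → ℝ) × unitInterval → ℝ))
      ((designLaw n Sig).prod ((noiseLaw n σ).prod volume)) :=
    (integrable_const (1 : ℝ)).indicator hs
  rw [modelLaw, map_measureReal_apply (measurable_modelMap θ) (measurableSet_reject T),
    ← integral_indicator_one hs, integral_prod _ hi]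
  congr 1
  ext X
  have hs2 := hs.preimage (measurable_prodMk_left (x := X))
  have hi2 : Integrable
      (fun a => A.indicator (1 : Design n p × (Fin n → ℝ) × unitInterval → ℝ) (X, a))
      ((noiseLaw n σ).prod volume) :=
    (integrable_const (1 : ℝ)).indicator hs2
  rw [integral_prod _ hi2, rejectProbMean]
  congr 1
  ext w
  rw [rejectProb, ← integral_indicator_one]
  · rfl
  · exact (measurableSet_reject T).preimage
      (f := fun U : unitInterval => ((fun k => ∑ j, X k j * θ j) + w, X, U)) (by fun_prop)

variable {Sig σ}

lemma reject_le_typeI {s₀ : ℕ} {i : Fin p} (T : Test n p) {θ : EuclideanSpace ℝ (Fin p)}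
    (h0 : l0norm θ ≤ s₀) (hi : θ i = 0) :
    (modelLaw n Sig σ θ).real {a | T.1 a = true} ≤ typeI Sig σ s₀ i T := by
  refine le_csSup ⟨1, ?_⟩ ⟨θ, h0, hi, rfl⟩
  rintro _ ⟨θ, -, -, rfl⟩
  exact measureReal_le_one

lemma one_sub_typeII_le_reject {s₀ : ℕ} {i : Fin p} {μ : ℝ} (T : Test n p)
    {θ : EuclideanSpace ℝ (Fin p)} (h0 : l0norm θ ≤ s₀) (hi : μ ≤ |θ i|) :
    1 - typeII Sig σ s₀ i μ T ≤ (modelLaw n Sig σ θ).real {a | T.1 a = true} := by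
  have h : (modelLaw n Sig σ θ).real {a | T.1 a = false} ≤ typeII Sig σ s₀ i μ T := by
    refine le_csSup ⟨1, ?_⟩ ⟨θ, h0, hi, rfl⟩
    rintro _ ⟨θ, -, -, rfl⟩
    exact measureReal_le_one
  have hc : {a | T.1 a = false} = {a | T.1 a = true}ᶜ := by
    ext a
    simp
  rw [hc, probReal_compl_eq_one_sub (measurableSet_reject T)] at h
  linarith

end Model

/-- The signal with coefficients `t` on `S` and coefficient `s` at `i`. -/
def sparseSignal (S : Finset (Fin p)) (i : Fin p) (t : S → ℝ) (s : ℝ) : EuclideanSpace ℝ (Fin p) :=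
  toLp 2 fun j => if h : j ∈ S then t ⟨j, h⟩ else if j = i then s else 0

section Signal

variable {S : Finset (Fin p)} {i : Fin p} (t : S → ℝ) (s : ℝ)

lemma sparseSignal_self (hiS : i ∉ S) : sparseSignal S i t s i = s := by
  simp [sparseSignal, hiS]

lemma l0norm_sparseSignal_le : l0norm (sparseSignal S i t s) ≤ S.card + 1 := by
  refine le_trans ?_ (Finset.card_insert_le i S)
  rw [← Set.ncard_coe_finset]
  refine Set.ncard_le_ncard (fun j hj => ?_) (Finset.finite_toSet _)
  by_contra h
  simp only [Finset.coe_insert, Set.mem_insert_iff, Finset.mem_coe, not_or] at h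
  exact hj (by simp [sparseSignal, h.1, h.2])

lemma mean_sparseSignal (hiS : i ∉ S) (X : Design n p) :
    (fun k => ∑ j, X k j * sparseSignal S i t s j) =
      designRestrict S X *ᵥ t + s • fun k => X k i := by
  ext k
  have e1 : ∑ j, X k j * sparseSignal S i t s j =
      ∑ j ∈ insert i S, X k j * sparseSignal S i t s j := by
    refine (Finset.sum_subset (Finset.subset_univ _) fun j _ hj => ?_).symm
    rw [Finset.mem_insert, not_or] at hj
    simp [sparseSignal, hj.1, hj.2]
  rw [e1, Finset.sum_insert hiS, sparseSignal_self t s hiS,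
    ← Finset.sum_coe_sort S (fun j => X k j * sparseSignal S i t s j)]
  simp [mulVec, dotProduct, designRestrict, rowRestrict, sparseSignal]
  ring

end Signal

section Bayes

variable {Sig : Matrix (Fin p) (Fin p) ℝ} {σ : ℝ}

/-- The coefficients of the regression of the `i`th column of the design on the columns in `S`. -/
def designCoeff (S : Finset (Fin p)) (i : Fin p) (X : Design n p) : S → ℝ :=
  leastSquares (designRestrict S X) fun k => X k i

/-- The residual of the regression of the `i`th column of the design on the columns in `S`. -/
def designResidual (S : Finset (Fin p)) (i : Fin p) (X : Design n p) : Fin n → ℝ :=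
  residual (designRestrict S X) fun k => X k i

lemma measurable_designPair (S : Finset (Fin p)) (i : Fin p) :
    Measurable fun X : Design n p =>
      (((fun k => rowRestrict S (X k)), fun k => X k i) : (Fin n → S → ℝ) × (Fin n → ℝ)) :=
  (measurable_pi_lambda _ fun k => (measurable_rowRestrict S).comp (measurable_pi_apply k)).prodMk
    (by fun_prop)

lemma measurable_designCoeff (S : Finset (Fin p)) (i : Fin p) :
    Measurable fun X : Design n p => designCoeff S i X := by
  have h := (measurable_leastSquares (n := n) (ι := S)).comp (measurable_designPair S i)
  simp only [Function.comp_def] at h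
  exact h

lemma measurable_designResidual (S : Finset (Fin p)) (i : Fin p) :
    Measurable fun X : Design n p => designResidual S i X := by
  have h := (measurable_residual (n := n) (ι := S)).comp (measurable_designPair S i)
  simp only [Function.comp_def] at h
  exact h

/-- This holds by definition of the residual, with no rank condition, so the conditional bound is
available for every design. -/
lemma column_eq (S : Finset (Fin p)) (i : Fin p) (X : Design n p) :
    (fun k => X k i) = designRestrict S X *ᵥ designCoeff S i X + designResidual S i X := by
  simp [designCoeff, designResidual, residual]

/-- Conditionally on the design, the average power of a test under the uniform prior on the
coefficients in `S` is bounded in terms of its average size. -/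
lemma average_power_le {u c μ R : ℝ} (hu : 0 < u) (hc : 0 ≤ c) (hR : 0 < R)
    (T : Test n p) (S : Finset (Fin p)) (i : Fin p) (X : Design n p) {Bad : Set (Design n p)}
    (hBad : X ∉ Bad → μ ^ 2 * ∑ k, designResidual S i X k ^ 2 ≤ σ ^ 2 * u ^ 2) :
    1 / 2 * ((∫ t, rejectProbMean σ T X (designRestrict S X *ᵥ t + μ • fun k => X k i)
        ∂cubeUniform S R) +
      ∫ t, rejectProbMean σ T X (designRestrict S X *ᵥ t + (-μ) • fun k => X k i)
        ∂cubeUniform S R) ≤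
      likelihoodRatio c u * (∫ t, rejectProbMean σ T X (designRestrict S X *ᵥ t) ∂cubeUniform S R) +
      (twoSidedPower c u - likelihoodRatio c u * twoSidedPower c 0) + Bad.indicator 1 X +
      cubeShiftError S.card R (|μ| * ‖designCoeff S i X‖) := by
  have hP := isProbabilityMeasure_cubeUniform (ι := S) hR
  have hψ : Measurable fun b => rejectProbMean σ T X b :=
    (measurable_rejectProbMean σ T).comp measurable_prodMk_left
  have hA (b : Fin n → ℝ) : Measurable fun t : S → ℝ => designRestrict S X *ᵥ t + b :=
    ((Continuous.matrix_mulVec continuous_const continuous_id).add continuous_const).measurable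
  have hA0 : Measurable fun t : S → ℝ => designRestrict S X *ᵥ t := by simpa using hA 0
  have hint (b : Fin n → ℝ) : Integrable
      (fun t => rejectProbMean σ T X (designRestrict S X *ᵥ t + b)) (cubeUniform S R) :=
    integrable_of_mem_unit (hψ.comp (hA b)) (fun _ => rejectProbMean_nonneg _ _ _ _)
      fun _ => rejectProbMean_le_one _ _ _ _
  have hint0 : Integrable
      (fun t => rejectProbMean σ T X (designRestrict S X *ᵥ t)) (cubeUniform S R) := by
    simpa using hint 0
  -- With `γ` the regression coefficients and `r` the residual, the mean is `X_S (t + s • γ) + s •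
  -- r`. Replacing the column by its residual is therefore a translation of the prior by `s • γ`.
  have shift (s : ℝ) (hs : |s| = |μ|) :
      ∫ t, rejectProbMean σ T X (designRestrict S X *ᵥ t + s • fun k => X k i) ∂cubeUniform S R ≤
      (∫ t, rejectProbMean σ T X (designRestrict S X *ᵥ t + s • designResidual S i X)
        ∂cubeUniform S R) + cubeShiftError S.card R (|μ| * ‖designCoeff S i X‖) := by
    have h := integral_cubeUniform_add_le hR
      (g := fun t => rejectProbMean σ T X (designRestrict S X *ᵥ t + s • designResidual S i X))
      (hψ.comp (hA _)) (fun _ => rejectProbMean_nonneg _ _ _ _)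
      (fun _ => rejectProbMean_le_one _ _ _ _) (s • designCoeff S i X)
    rw [norm_smul, Real.norm_eq_abs, hs, Fintype.card_coe] at h
    refine le_trans (le_of_eq ?_) h
    congr 1
    ext t
    rw [column_eq S i X, mulVec_add, mulVec_smul, smul_add, add_assoc]
  have h1 := shift μ rfl
  have h2 := shift (-μ) (abs_neg μ)
  have hK := twoSidedPower_sub_nonneg hc u
  have hpt (t : S → ℝ) :
      1 / 2 * (rejectProbMean σ T X (designRestrict S X *ᵥ t + μ • designResidual S i X) +
        rejectProbMean σ T X (designRestrict S X *ᵥ t + (-μ) • designResidual S i X)) ≤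
      likelihoodRatio c u * rejectProbMean σ T X (designRestrict S X *ᵥ t) +
      ((twoSidedPower c u - likelihoodRatio c u * twoSidedPower c 0) + Bad.indicator 1 X) := by
    -- On a bad design the power is bounded by one, which the indicator supplies; otherwise the
    -- Gaussian testing bound applies to the direction `μ • r`.
    by_cases hX : X ∈ Bad
    · have e1 := rejectProbMean_le_one σ T X
        (designRestrict S X *ᵥ t + μ • designResidual S i X)
      have e2 := rejectProbMean_le_one σ T X
        (designRestrict S X *ᵥ t + (-μ) • designResidual S i X)
      have e3 := mul_nonneg (likelihoodRatio_nonneg c u)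
        (rejectProbMean_nonneg σ T X (designRestrict S X *ᵥ t))
      simp only [Set.indicator_of_mem hX, Pi.one_apply]
      linarith
    · have hn := neyman_pearson_pi (σ := σ) hu hc (μ • designResidual S i X)
        (by simpa [mul_pow, ← Finset.mul_sum] using hBad hX)
        (measurable_rejectProb_right T X) (rejectProb_nonneg T X) (rejectProb_le_one T X)
        (designRestrict S X *ᵥ t)
      rw [Set.indicator_of_notMem hX, add_zero, neg_smul, ← sub_eq_add_neg]
      exact hn
  have hmono := integral_mono (μ := cubeUniform S R)
    (((hint (μ • designResidual S i X)).add (hint ((-μ) • designResidual S i X))).const_mul (1 / 2))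
    ((hint0.const_mul (likelihoodRatio c u)).add (integrable_const
      ((twoSidedPower c u - likelihoodRatio c u * twoSidedPower c 0) + Bad.indicator 1 X))) hpt
  simp only [Pi.add_apply] at hmono
  rw [integral_const_mul, integral_add (hint _) (hint _),
    integral_add (hint0.const_mul _) (integrable_const _), integral_const_mul, integral_const,
    probReal_univ, one_smul] at hmono
  linarith

end Bayes

end GaussianDesign
end

/-! ### Averaging over the design, and the limit of a flat prior. -/

noncomputable section
namespace GaussianDesign
open Matrix WithLp

variable {n p : ℕ} {Sig : Matrix (Fin p) (Fin p) ℝ} {σ : ℝ}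

lemma measurable_rejectProbMean_design (T : Test n p) (S : Finset (Fin p)) (i : Fin p) (s : ℝ) :
    Measurable fun q : (S → ℝ) × Design n p =>
      rejectProbMean σ T q.2 (designRestrict S q.2 *ᵥ q.1 + s • fun k => q.2 k i) := by
  have hm : Measurable fun q : (S → ℝ) × Design n p =>
      designRestrict S q.2 *ᵥ q.1 + s • fun k => q.2 k i := by
    refine measurable_pi_lambda _ fun k => ?_
    simp only [designRestrict, mulVec, dotProduct, rowRestrict, of_apply, Pi.add_apply,
      Pi.smul_apply]
    fun_prop
  exact (measurable_rejectProbMean σ T).comp (measurable_snd.prodMk hm)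

/-- The power of a test is bounded by its size, through the Neyman-Pearson bound for the two-sided
test, up to the probability that the signal-to-noise ratio of the residual exceeds `u`. -/
lemma power_le_of_bad {s₀ : ℕ} {i : Fin p} {S : Finset (Fin p)} (hiS : i ∉ S)
    (hS : S.card + 1 ≤ s₀) {μ α u c : ℝ} (hμ : 0 < μ) (hu : 0 < u) (hc : 0 ≤ c) (T : Test n p)
    (hT : typeI Sig σ s₀ i T ≤ α) {Bad : Set (Design n p)} (hBm : MeasurableSet Bad)
    (hBad : ∀ X ∉ Bad, μ ^ 2 * ∑ k, designResidual S i X k ^ 2 ≤ σ ^ 2 * u ^ 2) :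
    1 - typeII Sig σ s₀ i μ T ≤ likelihoodRatio c u * (α - twoSidedPower c 0) +
      twoSidedPower c u + (designLaw n Sig).real Bad := by
  set D := designLaw n Sig with hD
  set F : ℝ → (S → ℝ) → Design n p → ℝ := fun s t X =>
    rejectProbMean σ T X (designRestrict S X *ᵥ t + s • fun k => X k i) with hF
  have F0 (s : ℝ) (t : S → ℝ) (X : Design n p) : 0 ≤ F s t X := rejectProbMean_nonneg _ _ _ _
  have F1 (s : ℝ) (t : S → ℝ) (X : Design n p) : F s t X ≤ 1 := rejectProbMean_le_one _ _ _ _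
  have Fm (s : ℝ) : Measurable (Function.uncurry (F s)) :=
    measurable_rejectProbMean_design T S i s
  have FX (s : ℝ) (t : S → ℝ) : ∫ X, F s t X ∂D =
      (modelLaw n Sig σ (sparseSignal S i t s)).real {a | T.1 a = true} := by
    rw [modelLaw_reject]
    simp only [mean_sparseSignal t s hiS]
    rfl
  have size (t : S → ℝ) : ∫ X, F 0 t X ∂D ≤ α := by
    rw [FX]
    exact (reject_le_typeI T ((l0norm_sparseSignal_le t 0).trans hS)
      (sparseSignal_self t 0 hiS)).trans hT
  have power (s : ℝ) (hs : μ ≤ |s|) (t : S → ℝ) :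
      1 - typeII Sig σ s₀ i μ T ≤ ∫ X, F s t X ∂D := by
    rw [FX]
    exact one_sub_typeII_le_reject T ((l0norm_sparseSignal_le t s).trans hS)
      (by rwa [sparseSignal_self t s hiS])
  set err : ℝ → Design n p → ℝ := fun R X =>
    cubeShiftError S.card R (|μ| * ‖designCoeff S i X‖) with herr
  have errm (R : ℝ) : Measurable (err R) := by
    have := measurable_designCoeff (n := n) S i
    simp only [herr, cubeShiftError]
    fun_prop
  have err0 {R : ℝ} (hR : 0 < R) (X : Design n p) : 0 ≤ err R X :=
    cubeShiftError_nonneg _ hR.le (by positivity)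
  have err1 (R : ℝ) (X : Design n p) : err R X ≤ 1 := cubeShiftError_le_one _ _ _
  set L := likelihoodRatio c u
  have L0 : 0 ≤ L := likelihoodRatio_nonneg c u
  set K := twoSidedPower c u - L * twoSidedPower c 0 with hK
  have bound {R : ℝ} (hR : 0 < R) : 1 - typeII Sig σ s₀ i μ T ≤
      L * α + K + D.real Bad + ∫ X, err R X ∂D := by
    have hP := isProbabilityMeasure_cubeUniform (ι := S) hR
    set κ := cubeUniform S R
    have hprod (s : ℝ) : Integrable (Function.uncurry (F s)) (κ.prod D) :=
      integrable_of_mem_unit (Fm s) (fun _ => F0 _ _ _) fun _ => F1 _ _ _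
    -- Size and power are controlled for each fixed signal, averaging over designs, whereas the
    -- Neyman-Pearson bound is for a fixed design, averaging over signals. Fubini joins the two.
    have swap (s : ℝ) : ∫ t, ∫ X, F s t X ∂D ∂κ = ∫ X, ∫ t, F s t X ∂κ ∂D :=
      integral_integral_swap (hprod s)
    have avg (s : ℝ) (hs : μ ≤ |s|) :
        1 - typeII Sig σ s₀ i μ T ≤ ∫ X, ∫ t, F s t X ∂κ ∂D := by
      rw [← swap]
      calc 1 - typeII Sig σ s₀ i μ T = ∫ _, (1 - typeII Sig σ s₀ i μ T) ∂κ := by simp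
        _ ≤ _ := integral_mono (integrable_const _) (hprod s).integral_prod_left (power s hs)
    have avg0 : ∫ X, ∫ t, F 0 t X ∂κ ∂D ≤ α := by
      rw [← swap]
      calc _ ≤ ∫ _, α ∂κ := integral_mono (hprod 0).integral_prod_left (integrable_const _) size
        _ = α := by simp
    have ii (s : ℝ) : Integrable (fun X => ∫ t, F s t X ∂κ) D := (hprod s).integral_prod_right
    have ib : Integrable (Bad.indicator (1 : Design n p → ℝ)) D :=
      (integrable_const (1 : ℝ)).indicator hBm
    have ie : Integrable (err R) D := integrable_of_mem_unit (errm R) (err0 hR) (err1 R)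
    have hpt (X : Design n p) : 1 / 2 * ((∫ t, F μ t X ∂κ) + ∫ t, F (-μ) t X ∂κ) ≤
        (L * (∫ t, F 0 t X ∂κ) + K + Bad.indicator 1 X) + err R X := by
      have := average_power_le (σ := σ) (c := c) hu hc hR T S i X (hBad X)
      simpa only [hF, zero_smul, add_zero] using this
    have i1 : Integrable (fun X => L * (∫ t, F 0 t X ∂κ) + K) D :=
      ((ii 0).const_mul L).add (integrable_const K)
    have i2 : Integrable (fun X => L * (∫ t, F 0 t X ∂κ) + K + Bad.indicator 1 X) D := i1.add ib
    have hmono := integral_mono (((ii μ).add (ii (-μ))).const_mul (1 / 2)) (i2.add ie) hpt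
    simp only [Pi.add_apply] at hmono
    rw [integral_const_mul, integral_add (ii _) (ii _), integral_add i2 ie, integral_add i1 ib,
      integral_add ((ii 0).const_mul L) (integrable_const K), integral_const_mul, integral_const,
      probReal_univ, one_smul, integral_indicator_one hBm] at hmono
    have h1 := avg μ (le_abs_self μ)
    have h2 := avg (-μ) (by rw [abs_neg]; exact le_abs_self μ)
    have h3 := mul_le_mul_of_nonneg_left avg0 L0
    linarith
  -- The translation `μγ` depends on the design and has no uniform bound. The cap at one in
  -- `cubeShiftError` provides the domination needed to let `R → ∞`.
  have lim : Filter.Tendsto (fun m : ℕ => ∫ X, err ((m : ℝ) + 1) X ∂D) Filter.atTop (nhds 0) := by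
    have h := tendsto_integral_of_dominated_convergence (μ := D)
      (F := fun (m : ℕ) X => err ((m : ℝ) + 1) X) (f := fun _ => 0) (fun _ => 1)
      (fun m => (errm _).aestronglyMeasurable) (integrable_const 1)
      (fun m => ae_of_all _ fun X => by
        rw [Real.norm_eq_abs, abs_of_nonneg (err0 (by positivity) X)]; exact err1 _ X)
      (ae_of_all _ fun X => (tendsto_cubeShiftError S.card _).comp
        (Filter.tendsto_atTop_add_const_right _ 1 tendsto_natCast_atTop_atTop))
    simpa using h
  have h := ge_of_tendsto' (lim.const_add (L * α + K + D.real Bad))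
    fun m : ℕ => bound (R := (m : ℝ) + 1) (by positivity)
  rw [add_zero, hK] at h
  linarith

/-- The number of degrees of freedom and the residual variance are governed by a set of `s₀ - 1`
coordinates containing `S`. -/
lemma designLaw_residual_tail_of_card_lt {s₀ : ℕ} (hSig : Sig.PosDef) (hsp : s₀ ≤ p)
    (hsn : s₀ ≤ n + 1) {i : Fin p} {S : Finset (Fin p)} (hiS : i ∉ S) (hS : S.card < s₀) {c : ℝ}
    (hc : 0 ≤ c) :
    ∃ S' : Finset (Fin p), i ∉ S' ∧ S'.card + 1 = s₀ ∧
      (designLaw n Sig).real {X | condVariance Sig i S * c < ∑ k, designResidual S' i X k ^ 2} ≤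
        chiSquaredTail (n + 1 - s₀) c := by
  -- Size `s₀ - 1` leaves room for exactly one more nonzero coefficient, at `i`, and gives `n - (s₀
  -- - 1) = n + 1 - s₀` degrees of freedom.
  obtain ⟨S', hSS, hS'i, hcard⟩ := Finset.exists_subsuperset_card_eq
    (s := S) (t := Finset.univ.erase i) (n := s₀ - 1)
    (fun j hj => Finset.mem_erase.2 ⟨fun h => hiS (h ▸ hj), Finset.mem_univ j⟩) (by omega)
    (by simp; omega)
  have hiS' : i ∉ S' := fun h => Finset.notMem_erase i _ (hS'i h)
  refine ⟨S', hiS', by omega, ?_⟩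
  have h := designLaw_residual_tail hSig hiS' (n := n) (by omega) c
  rw [show n - S'.card = n + 1 - s₀ by omega] at h
  refine le_trans (measureReal_mono fun X hX => ?_) h
  exact lt_of_le_of_lt (mul_le_mul_of_nonneg_right (condVariance_anti hSig hSS hiS') hc) hX

lemma chiSquaredTail_nonneg (k : ℕ) (x : ℝ) : 0 ≤ chiSquaredTail k x := measureReal_nonneg

lemma chiSquaredTail_of_nonpos (k : ℕ) {x : ℝ} (hx : x ≤ 0) : chiSquaredTail k x = 1 := by
  have hm : Measurable fun z : Fin k → ℝ => ∑ j, z j ^ 2 := by fun_prop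
  rw [chiSquaredTail, chiSquared, show {z : ℝ | x ≤ z} = Set.Ici x from rfl,
    map_measureReal_apply hm measurableSet_Ici]
  have : (fun z : Fin k → ℝ => ∑ j, z j ^ 2) ⁻¹' Set.Ici x = Set.univ :=
    Set.eq_univ_of_forall fun z => hx.trans (Finset.sum_nonneg fun j _ => sq_nonneg (z j))
  rw [this, probReal_univ]

lemma typeII_nonneg (s₀ : ℕ) (i : Fin p) (μ : ℝ) (T : Test n p) : 0 ≤ typeII Sig σ s₀ i μ T :=
  Real.sSup_nonneg (by rintro _ ⟨θ, -, -, rfl⟩; exact measureReal_nonneg)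

end GaussianDesign
end

theorem theorem2p5 {n p s₀ : ℕ} (hsp : s₀ ≤ p) (hsn : s₀ ≤ n + 1)
    (Sig : Matrix (Fin p) (Fin p) ℝ) (hSig : Sig.PosDef)
    (σ : ℝ) (hσ : 0 < σ) (μ : ℝ) (hμ : 0 < μ)
    (α : ℝ) (hα : α ∈ Set.Icc (0 : ℝ) 1)
    (i : Fin p) (S : Finset (Fin p)) (hiS : i ∉ S) (hS : S.card < s₀) (l : ℝ) :
    GaussianDesign.minimaxPower n Sig σ s₀ i α μ ≤
      GaussianDesign.G α (μ / GaussianDesign.sigmaEff n Sig σ s₀ i S l) +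
        GaussianDesign.chiSquaredTail (n + 1 - s₀) ((n : ℝ) - (s₀ : ℝ) + l) := by
  open GaussianDesign in
  -- Nonnegativity of the bound covers the convention that the supremum of the empty set is zero.
  refine Real.sSup_le ?_ (add_nonneg (G_nonneg _ _) (chiSquaredTail_nonneg _ _))
  rintro _ ⟨T, hT, rfl⟩
  rcases le_or_gt ((n : ℝ) - s₀ + l) 0 with hx | hx
  -- Here the tail equals one and the claim is trivial, whatever value `G` takes.
  · rw [chiSquaredTail_of_nonpos _ hx]
    have h1 := G_nonneg α (μ / sigmaEff n Sig σ s₀ i S l)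
    have h2 := typeII_nonneg (Sig := Sig) (σ := σ) s₀ i μ T
    linarith
  · obtain ⟨S', hiS', hcard, htail⟩ :=
      designLaw_residual_tail_of_card_lt hSig hsp hsn hiS hS hx.le
    have hv := mul_pos (condVariance_pos hSig i S hiS) hx
    have hu : 0 < μ / sigmaEff n Sig σ s₀ i S l :=
      div_pos hμ (div_pos hσ (Real.sqrt_pos.2 hv))
    -- With `u = μ/σ_eff(ℓ)`, the condition `μ² ‖r‖² ≤ σ² u²` becomes `‖r‖² ≤ Σ_{i|S} (n - s₀ + ℓ)`.
    -- The prior and the residual use `S'`, while the threshold keeps the variance for the original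
    -- `S`.
    have hu2 : σ ^ 2 * (μ / sigmaEff n Sig σ s₀ i S l) ^ 2 =
        μ ^ 2 * (condVariance Sig i S * ((n : ℝ) - s₀ + l)) := by
      rw [sigmaEff, div_div_eq_mul_div, div_pow, mul_pow, Real.sq_sqrt hv.le]
      field_simp
    refine le_G_add hα fun c hc => ?_
    have hm : MeasurableSet {X : Design n p | condVariance Sig i S * ((n : ℝ) - s₀ + l) <
        ∑ k, designResidual S' i X k ^ 2} :=
      measurableSet_lt measurable_const (Finset.measurable_sum _ fun k _ =>
        ((measurable_pi_apply k).comp (measurable_designResidual S' i)).pow_const 2)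
    have h := power_le_of_bad (c := c) hiS' hcard.le hμ hu hc T hT hm fun X hX => by
      rw [hu2]
      exact mul_le_mul_of_nonneg_left (not_lt.1 hX) (sq_nonneg μ)
    linarith
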